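/- Let $T=(V,E)$ be a finite tree with leaf set $\delta\Omega$ (the vertices with exactly one neighbour). A real number $\lambda\ge 0$ is a Steklov eigenvalue of $T$ if there is a function $f\colon V\to\mathbb R$, not identically zero, such that $\sum_{w\sim v}(f(v)-f(w))=0$ for every $v\in V\setminus\delta\Omega$ and $f(\omega)-f(\omega')=\lambda f(\omega)$ for every leaf $\omega\in\delta\Omega$ with neighbour $\omega'$. Let $\lambda_2(T)$ be the smallest positive Steklov eigenvalue of $T$. A spider $S(\ell_1,\dots,\ell_b)$, with all $\ell_i\ge1$, is the tree obtained by gluing together one endpoint of each of $b$ paths of lengths $\ell_1,\dots,\ell_b$. A double spider $\mathrm{DS}(a_1,\dots,a_p;b_1,\dots,b_q)$, where $p,q\ge1$, $a_1\ge\cdots\ge a_p\ge1$ and $b_1\ge\cdots\ge b_q\ge1$, is the tree obtained from an edge $uv$ by attaching $p$ internally disjoint paths of lengths $a_1,\dots,a_p$ at $u$ and $q$ internally disjoint paths of lengths $b_1,\dots,b_q$ at $v$. **Theorem.** Let $D=2r+1\ge3$ be odd and let $n\ge D+1$. 1. For every tree $T$ of order $n$ and diameter $D$ there is a double spider $\mathrm{DS}(a_1,\dots,a_p;b_1,\dots,b_q)$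 of order $n$ and diameter $D$ such that $a_1=b_1=r$, every $a_i$ and every $b_j$ is at most $r$, and $$\lambda_2(T)\le\lambda_2\bigl(\mathrm{DS}(a_1,\dots,a_p;b_1,\dots,b_q)\bigr);$$ moreover, if equality holds for this double spider, then $T$ itself is (isomorphic to) a double spider. 2. Every double spider that maximizes $\lambda_2$ among the double spiders of order $n$ and diameter $D$ is (isomorphic to) a spider. 3. Every tree that maximizes $\lambda_2$ among all trees of order $n$ and diameter $D$ is (isomorphic to) a spider. -/

import Mathlib

/-- A leaf (boundary vertex) of a graph: a vertex with exactly one neighbour. -/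
def IsLeaf {V : Type*} (G : SimpleGraph V) (v : V) : Prop :=
  ∃! w, G.Adj v w

open Classical in
/-- The discrete Laplacian `Δ f (v) = ∑_{w ∼ v} (f v - f w)`. -/
noncomputable def graphLaplacian {V : Type*} [Fintype V] (G : SimpleGraph V)
    (f : V → ℝ) (v : V) : ℝ :=
  ∑ w ∈ Finset.univ.filter (fun w => G.Adj v w), (f v - f w)

/-- `μ` is a Steklov eigenvalue of `G` with the leaf set as boundary: `μ ≥ 0` and there is a
nonzero function that is harmonic at every non-leaf vertex and whose outward normal derivative
`f ω - f ω'` at each leaf `ω` (with unique neighbour `ω'`) equals `μ * f ω`. -/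
def IsSteklovEigenvalue {V : Type*} [Fintype V] (G : SimpleGraph V) (μ : ℝ) : Prop :=
  0 ≤ μ ∧ ∃ f : V → ℝ, f ≠ 0 ∧
    (∀ v, ¬ IsLeaf G v → graphLaplacian G f v = 0) ∧
    (∀ ω ω', IsLeaf G ω → G.Adj ω ω' → f ω - f ω' = μ * f ω)

/-- `λ₂`, the first nonzero Steklov eigenvalue. On a finite tree with at least two vertices the
eigenvalue `0` is simple (the tree is connected), so this is the second entry of the ordered
spectrum; there the set below is finite and nonempty, so that the infimum is a minimum. -/
noncomputable def steklovLambda₂ {V : Type*} [Fintype V] (G : SimpleGraph V) : ℝ :=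
  sInf {μ : ℝ | 0 < μ ∧ IsSteklovEigenvalue G μ}

/-- Vertices of a spider with `b` legs of lengths `ℓ i`: `none` is the center, and
`some ⟨i, k⟩` is the vertex of the `i`-th leg at distance `k + 1` from the center. -/
abbrev SpiderVertex {b : ℕ} (ℓ : Fin b → ℕ) : Type :=
  Option (Σ i : Fin b, Fin (ℓ i))

/-- The edges of a spider, oriented away from the center. -/
def spiderStep {b : ℕ} (ℓ : Fin b → ℕ) : SpiderVertex ℓ → SpiderVertex ℓ → Prop
  | none, some ⟨_, k⟩ => (k : ℕ) = 0
  | some ⟨i, k⟩, some ⟨j, m⟩ => i = j ∧ (m : ℕ) = (k : ℕ) + 1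
  | _, none => False

/-- The spider `S(ℓ₁, …, ℓ_b)`: paths of lengths `ℓ i` glued at one common endpoint. -/
def spider {b : ℕ} (ℓ : Fin b → ℕ) : SimpleGraph (SpiderVertex ℓ) :=
  SimpleGraph.fromRel (spiderStep ℓ)

/-- The double spider `DS(a₁, …, a_p ; b₁, …, b_q)`: the two spiders `S(a)` and `S(b)`, whose
centers `u = inl none` and `v = inr none` are joined by one edge. -/
def doubleSpider {p q : ℕ} (a : Fin p → ℕ) (b : Fin q → ℕ) :
    SimpleGraph (SpiderVertex a ⊕ SpiderVertex b) :=
  SimpleGraph.sum (spider a) (spider b) ⊔ SimpleGraph.edge (Sum.inl none) (Sum.inr none)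

/-- Admissible arm lengths on one side of a double spider: `a₁ ≥ a₂ ≥ ⋯ ≥ a_p ≥ 1`. -/
def IsArmProfile {p : ℕ} (a : Fin p → ℕ) : Prop :=
  Antitone a ∧ ∀ i, 1 ≤ a i

/-- `G` is (isomorphic to) a spider. -/
def IsSpider {V : Type*} (G : SimpleGraph V) : Prop :=
  ∃ (b : ℕ) (ℓ : Fin b → ℕ), (∀ i, 1 ≤ ℓ i) ∧ Nonempty (G ≃g spider ℓ)

/-- `G` is (isomorphic to) a double spider, with at least one arm on each side. -/
def IsDoubleSpider {V : Type*} (G : SimpleGraph V) : Prop :=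
  ∃ (p q : ℕ) (a : Fin (p + 1) → ℕ) (b : Fin (q + 1) → ℕ),
    IsArmProfile a ∧ IsArmProfile b ∧ Nonempty (G ≃g doubleSpider a b)

/-!
If a charge `g` is carried by the leaves of a tree and has total mass zero, the potential
`x ↦ -½ ∑ y, d(y, x) g y` solves `Δφ = g`, so `1 / λ₂` is the maximum of the flow energy
`-½ ∑ x, ∑ y, d(x, y) g x g y` over `∑ x, g x ^ 2`.  Split the tree at the middle edge `uv` of a
diametral path.  The flow energy is then the square of the flow through `uv` plus
`∑ g x g x' (x | x')` over pairs of leaves on the same side, where the Gromov product `(x | x')` is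
the length shared by the paths from the centre to `x` and `x'`.  For a double spider the shared
lengths vanish off the diagonal, and `1 / λ₂` is the root `μ` of the secular equation
`1 / ∑ (μ - aᵢ)⁻¹ + 1 / ∑ (μ - bⱼ)⁻¹ = 1`.

Shorten the depths of the leaves to the arm lengths of a double spider of the same order.
The extremal charge of this double spider, placed on the leaves of the tree, shows that the tree has
the smaller `λ₂`, strictly so if two leaves on one side have a positive shared length.  Moving all
arms of one side but a longest one to the other side decreases `μ`, and a double spider with a
single arm on one side is a spider.
-/

open Finset SimpleGraph

section Trees

variable {V : Type*} {G : SimpleGraph V}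

/-- `w` lies on a shortest walk from `u` to `x`. -/
abbrev IsBetween (G : SimpleGraph V) (u w x : V) : Prop :=
  G.dist u w + G.dist w x = G.dist u x

lemma dist_le_dist_add_one_of_adj (hG : G.Connected) (u : V) {v w : V} (hvw : G.Adj v w) :
    G.dist u w ≤ G.dist u v + 1 :=
  hG.dist_triangle.trans_eq (by rw [dist_eq_one_iff_adj.mpr hvw])

lemma exists_adj_dist_add_one_eq (hG : G.Connected) {u v : V} (hne : v ≠ u) :
    ∃ w, G.Adj v w ∧ G.dist u w + 1 = G.dist u v := by
  obtain ⟨p, hp⟩ := hG.exists_walk_length_eq_dist v u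
  cases p with
  | nil => exact absurd rfl hne
  | @cons _ w _ hvw q =>
    refine ⟨w, hvw, le_antisymm ?_ (dist_le_dist_add_one_of_adj hG u hvw.symm)⟩
    calc G.dist u w + 1 ≤ q.length + 1 := by rw [dist_comm]; gcongr; exact dist_le q
      _ = G.dist u v := by rw [← Walk.length_cons hvw, hp, dist_comm]

lemma exists_isBetween_dist_eq (hG : G.Connected) {u x : V} {k : ℕ} (hk : k ≤ G.dist u x) :
    ∃ w, IsBetween G u w x ∧ G.dist u w = k := by
  induction k with
  | zero => exact ⟨u, by simp, by simp⟩
  | succ k ih =>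
    obtain ⟨w, hw, hwk⟩ := ih (by omega)
    have hwx : w ≠ x := by rintro rfl; omega
    obtain ⟨w', hadj, hd⟩ := exists_adj_dist_add_one_eq hG hwx
    have htri := hG.dist_triangle (u := u) (v := w') (w := x)
    have hstep := dist_le_dist_add_one_of_adj hG u hadj
    rw [dist_comm, G.dist_comm (u := x)] at hd
    exact ⟨w', by omega, by omega⟩

lemma sub_le_dist_of_adj (hG : G.Connected) {φ : V → ℤ}
    (hφ : ∀ v w, G.Adj v w → |φ v - φ w| ≤ 1) (x y : V) : φ y - φ x ≤ G.dist x y := by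
  obtain ⟨p, hp⟩ := hG.exists_walk_length_eq_dist x y
  rw [← hp]
  clear hp
  induction p with
  | nil => simp
  | cons hadj p ih =>
    have := (abs_le.mp (hφ _ _ hadj)).1
    rw [Walk.length_cons]
    push_cast
    linarith

lemma eq_of_adj_of_dist_add_one_eq (hG : G.IsTree) {u v w w' : V} (hw : G.Adj v w)
    (hw' : G.Adj v w') (hd : G.dist u w + 1 = G.dist u v) (hd' : G.dist u w' + 1 = G.dist u v) :
    w = w' := by
  obtain ⟨p, hp⟩ := hG.connected.exists_walk_length_eq_dist u w
  obtain ⟨q, hq⟩ := hG.connected.exists_walk_length_eq_dist u w'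
  have hp' : (p.concat hw.symm).IsPath :=
    Walk.isPath_of_length_eq_dist _ (by rw [Walk.length_concat, hp, hd])
  have hq' : (q.concat hw'.symm).IsPath :=
    Walk.isPath_of_length_eq_dist _ (by rw [Walk.length_concat, hq, hd'])
  have hpq := congrArg (fun p : G.Path u v => (p : G.Walk u v).penultimate)
    ((hG.isAcyclic.subsingleton_path u v).elim ⟨_, hp'⟩ ⟨_, hq'⟩)
  simpa using hpq

lemma dist_eq_add_one_of_adj_of_ne (hG : G.IsTree) {u v w w' : V} (hw : G.Adj v w)
    (hw' : G.Adj v w') (hd : G.dist u w + 1 = G.dist u v) (hne : w' ≠ w) :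
    G.dist u w' = G.dist u v + 1 :=
  (hG.dist_eq_dist_add_one_of_adj u hw').resolve_left fun hd' =>
    hne (eq_of_adj_of_dist_add_one_eq hG hw' hw hd'.symm hd)

lemma eq_of_isBetween_of_dist_eq (hG : G.IsTree) {u x w w' : V} (hw : IsBetween G u w x)
    (hw' : IsBetween G u w' x) (hd : G.dist u w = G.dist u w') : w = w' := by
  induction hn : G.dist w x generalizing w w' with
  | zero =>
    rw [hG.connected.dist_eq_zero_iff.mp hn]
    exact (hG.connected.dist_eq_zero_iff.mp (by omega : G.dist w' x = 0)).symm
  | succ n ih =>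
    have hwx : w ≠ x := by rintro rfl; simp at hn
    have hwx' : w' ≠ x := by rintro rfl; simp at hw'; omega
    obtain ⟨z, hz, hzd⟩ := exists_adj_dist_add_one_eq hG.connected hwx
    obtain ⟨z', hz', hzd'⟩ := exists_adj_dist_add_one_eq hG.connected hwx'
    rw [dist_comm, G.dist_comm (u := x)] at hzd hzd'
    have htri := hG.connected.dist_triangle (u := u) (v := z) (w := x)
    have htri' := hG.connected.dist_triangle (u := u) (v := z') (w := x)
    have hstep := dist_le_dist_add_one_of_adj hG.connected u hz
    have hstep' := dist_le_dist_add_one_of_adj hG.connected u hz'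
    obtain rfl := ih (w := z) (w' := z') (by omega) (by omega) (by omega) (by omega)
    exact eq_of_adj_of_dist_add_one_eq hG hz.symm hz'.symm (u := u) (by omega) (by omega)

lemma bijOn_dist_isBetween (hG : G.IsTree) (u x : V) :
    Set.BijOn (G.dist u) {w | IsBetween G u w x} (Set.Iic (G.dist u x)) :=
  ⟨fun _ hw => Nat.le.intro hw, fun _ hw _ hw' => eq_of_isBetween_of_dist_eq hG hw hw',
    fun _ hk => exists_isBetween_dist_eq hG.connected hk⟩

lemma ncard_isBetween (hG : G.IsTree) (u x : V) :
    {w | IsBetween G u w x}.ncard = G.dist u x + 1 := by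
  rw [← (bijOn_dist_isBetween hG u x).injOn.ncard_image, (bijOn_dist_isBetween hG u x).image_eq]
  simp [Set.ncard_eq_toFinset_card']

lemma dist_eq_of_isBetween_of_isBetween (hG : G.IsTree) {x w y z : V} (hne : w ≠ y)
    (hxy : IsBetween G x w y) (hwz : IsBetween G w y z) :
    G.dist x z = G.dist x w + G.dist w z := by
  induction hn : G.dist y z generalizing z with
  | zero =>
    obtain rfl := hG.connected.dist_eq_zero_iff.mp hn
    exact Eq.symm hxy
  | succ n ih =>
    have hzy : z ≠ y := by rintro rfl; simp at hn
    obtain ⟨z', hz', hzd'⟩ := exists_adj_dist_add_one_eq hG.connected hzy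
    have htri := hG.connected.dist_triangle (u := w) (v := y) (w := z')
    have hstep := dist_le_dist_add_one_of_adj hG.connected w hz'.symm
    have hxz' := ih (z := z') (by omega) (by omega)
    have hpos := hG.connected.pos_dist_of_ne hne
    have hwz' : z' ≠ w := by rintro rfl; simp at htri; omega
    obtain ⟨z'', hz'', hzd''⟩ := exists_adj_dist_add_one_eq hG.connected hwz'
    have htri' := hG.connected.dist_triangle (u := x) (v := w) (w := z'')
    have hstep' := dist_le_dist_add_one_of_adj hG.connected x hz''.symm
    have := dist_eq_add_one_of_adj_of_ne hG (u := x) hz'' hz'.symm (by omega)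
      (by rintro rfl; omega)
    omega

/-- `G` is the tree with the given root in which the parent of `v ≠ root` is `π v`, and `h` is the
height above the root. -/
structure IsParentMap (G : SimpleGraph V) (root : V) (π : V → V) (h : V → ℕ) : Prop where
  adj_iff : ∀ v w, G.Adj v w ↔ (v ≠ root ∧ w = π v) ∨ (w ≠ root ∧ v = π w)
  height_root : h root = 0
  height_parent : ∀ v ≠ root, h (π v) + 1 = h v

namespace IsParentMap

variable {root : V} {π : V → V} {h : V → ℕ}

lemma adj_parent (hπ : IsParentMap G root π h) {v : V} (hv : v ≠ root) : G.Adj v (π v) :=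
  (hπ.adj_iff v _).mpr (.inl ⟨hv, rfl⟩)

lemma exists_walk (hπ : IsParentMap G root π h) (v : V) : ∃ p : G.Walk v root, p.length = h v := by
  induction hn : h v generalizing v with
  | zero =>
    obtain rfl : v = root := by
      by_contra hv
      exact absurd (hπ.height_parent v hv) (by omega)
    exact ⟨.nil, rfl⟩
  | succ n ih =>
    have hv : v ≠ root := by rintro rfl; simp [hπ.height_root] at hn
    obtain ⟨p, hp⟩ := ih (π v) (by have := hπ.height_parent v hv; omega)
    exact ⟨.cons (hπ.adj_parent hv) p, by rw [Walk.length_cons, hp]⟩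

lemma connected (hπ : IsParentMap G root π h) : G.Connected :=
  (connected_iff_exists_forall_reachable _).mpr
    ⟨root, fun v => let ⟨p, _⟩ := hπ.exists_walk v; p.reachable.symm⟩

lemma sub_le_dist (hπ : IsParentMap G root π h) {φ : V → ℤ}
    (hφ : ∀ v ≠ root, |φ v - φ (π v)| ≤ 1) (x y : V) : φ y - φ x ≤ G.dist x y := by
  refine sub_le_dist_of_adj hπ.connected (fun v w hvw => ?_) x y
  rcases (hπ.adj_iff v w).mp hvw with ⟨hv, rfl⟩ | ⟨hw, rfl⟩
  exacts [hφ v hv, (abs_sub_comm _ _).trans_le (hφ w hw)]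

lemma dist_root (hπ : IsParentMap G root π h) (v : V) : G.dist root v = h v := by
  refine le_antisymm ?_ ?_
  · obtain ⟨p, hp⟩ := hπ.exists_walk v
    rw [dist_comm, ← hp]
    exact dist_le p
  · have := hπ.sub_le_dist (φ := fun v => h v)
      (fun v hv => by simp [← hπ.height_parent v hv]) root v
    rw [hπ.height_root] at this
    omega

lemma isTree [Finite V] (hπ : IsParentMap G root π h) : G.IsTree := by
  refine isTree_iff_connected_and_card.mpr
    ⟨hπ.connected, le_antisymm ?_ hπ.connected.card_vert_le_card_edgeSet_add_one⟩
  have hsub : G.edgeSet ⊆ (fun v => s(v, π v)) '' {root}ᶜ := by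
    rintro ⟨v, w⟩ hvw
    rcases (hπ.adj_iff v w).mp hvw with ⟨hv, rfl⟩ | ⟨hw, rfl⟩
    exacts [⟨v, hv, rfl⟩, ⟨w, hw, Sym2.eq_swap⟩]
  calc Nat.card G.edgeSet + 1 ≤ ({root}ᶜ : Set V).ncard + 1 := by
        gcongr
        exact (Set.ncard_le_ncard hsub (Set.toFinite _)).trans (Set.ncard_image_le (Set.toFinite _))
    _ = Nat.card V := by rw [← Set.ncard_add_ncard_compl {root}, Set.ncard_singleton, add_comm]

lemma isLeaf_iff (hπ : IsParentMap G root π h) {v : V} (hv : v ≠ root) :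
    IsLeaf G v ↔ ∀ w ≠ root, π w ≠ v := by
  refine ⟨?_, fun hchild => ⟨π v, hπ.adj_parent hv, fun w hw => ?_⟩⟩
  · rintro hleaf w hw rfl
    have heq : w = π (π w) := hleaf.unique (hπ.adj_parent hw).symm (hπ.adj_parent hv)
    have hw' := hπ.height_parent w hw
    have hv' := hπ.height_parent _ hv
    rw [← heq] at hv'
    omega
  · rcases (hπ.adj_iff v w).mp hw with ⟨-, rfl⟩ | ⟨hwr, rfl⟩
    exacts [rfl, absurd rfl (hchild w hwr)]

end IsParentMap

lemma not_isLeaf_of_adj_of_adj {x y z : V} (hy : G.Adj x y) (hz : G.Adj x z) (hne : y ≠ z) :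
    ¬ IsLeaf G x := fun hx => hne (hx.unique hy hz)

lemma not_isLeaf_of_isBetween (hG : G.Connected) {u w x : V} (hu : w ≠ u) (hx : w ≠ x)
    (hw : IsBetween G u w x) : ¬ IsLeaf G w := by
  obtain ⟨y, hy, hyd⟩ := exists_adj_dist_add_one_eq hG hu
  obtain ⟨z, hz, hzd⟩ := exists_adj_dist_add_one_eq hG hx
  refine not_isLeaf_of_adj_of_adj hy hz ?_
  rintro rfl
  have htri := hG.dist_triangle (u := u) (v := y) (w := x)
  rw [dist_comm, G.dist_comm (u := x)] at hzd
  omega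

lemma exists_adj_dist_eq_add_one (hG : G.IsTree) {u x : V} (hx : ¬ IsLeaf G x) (hne : x ≠ u) :
    ∃ y, G.Adj x y ∧ G.dist u y = G.dist u x + 1 := by
  obtain ⟨w, hw, hd⟩ := exists_adj_dist_add_one_eq hG.connected hne
  by_contra! hcon
  refine hx ⟨w, hw, fun y hy => ?_⟩
  by_contra hyw
  exact hcon y hy (dist_eq_add_one_of_adj_of_ne hG hw hy hd hyw)

lemma ne_of_isBetween (hG : G.Connected) {u w x : V} (hw : w ≠ u) (h : IsBetween G u w x) :
    x ≠ u := by
  rintro rfl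
  exact hw (hG.dist_eq_zero_iff.mp (Nat.add_eq_zero_iff.mp (h.trans G.dist_self)).2)

lemma exists_isLeaf_isBetween [Finite V] (hG : G.IsTree) {u w : V} (hw : w ≠ u) :
    ∃ x, IsLeaf G x ∧ IsBetween G u w x := by
  obtain ⟨x, hx, hmax⟩ := Set.exists_max_image {x | IsBetween G u w x} (G.dist u)
    (Set.toFinite _) ⟨w, by simp⟩
  refine ⟨x, ?_, hx⟩
  by_contra hleaf
  have hxu : x ≠ u := ne_of_isBetween hG.connected hw hx
  obtain ⟨y, hy, hd⟩ := exists_adj_dist_eq_add_one hG hleaf hxu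
  have htri := hG.connected.dist_triangle (u := u) (v := w) (w := y)
  have hstep := dist_le_dist_add_one_of_adj hG.connected w hy
  simp only [Set.mem_ofPred_eq] at hx hmax
  have := hmax y (by omega)
  omega

lemma exists_isLeaf_isLeaf_ne [Finite V] [Nontrivial V] (hG : G.IsTree) :
    ∃ x y, IsLeaf G x ∧ IsLeaf G y ∧ x ≠ y := by
  obtain ⟨u, w, huw⟩ := exists_pair_ne V
  obtain ⟨x, hx, hux⟩ := exists_isLeaf_isBetween hG huw.symm
  have hxu := ne_of_isBetween hG.connected huw.symm hux
  obtain ⟨y, hy, hxy⟩ := exists_isLeaf_isBetween hG hxu.symm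
  exact ⟨x, y, hx, hy, (ne_of_isBetween hG.connected hxu.symm hxy).symm⟩

lemma dist_le_diam_of_connected [Finite V] (hG : G.Connected) (u v : V) :
    G.dist u v ≤ G.diam :=
  have := hG.nonempty
  dist_le_diam (connected_iff_ediam_ne_top.mp hG)

lemma isLeaf_of_dist_eq_diam [Finite V] (hG : G.IsTree) {x y : V} (hne : x ≠ y)
    (hxy : G.dist x y = G.diam) : IsLeaf G x := by
  by_contra hleaf
  obtain ⟨z, -, hz⟩ := exists_adj_dist_eq_add_one hG hleaf hne
  have := dist_le_diam_of_connected hG.connected y z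
  rw [dist_comm] at hxy
  omega

end Trees

section Spectral

open Matrix Module.End

lemma exists_hasEigenvalue_ge {E : Type*} [NormedAddCommGroup E] [InnerProductSpace ℝ E]
    [FiniteDimensional ℝ E] {T : E →ₗ[ℝ] E} (hT : T.IsSymmetric) {x : E} (hx : x ≠ 0) {μ : ℝ}
    (hle : μ * ‖x‖ ^ 2 ≤ inner ℝ (T x) x) : ∃ Λ, μ ≤ Λ ∧ HasEigenvalue T Λ := by
  have : Nontrivial E := nontrivial_of_ne x 0 hx
  refine ⟨_, ?_, hT.hasEigenvalue_iSup_of_finiteDimensional⟩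
  have hbdd : BddAbove (Set.range fun y : {y : E // y ≠ 0} =>
      RCLike.re (inner ℝ (T y) y) / ‖(y : E)‖ ^ 2) := by
    refine ⟨‖LinearMap.toContinuousLinearMap T‖, ?_⟩
    rintro _ ⟨y, rfl⟩
    exact (le_abs_self _).trans
      ((LinearMap.toContinuousLinearMap T).rayleighQuotient_le_norm (y : E))
  refine le_trans ?_ (le_ciSup hbdd ⟨x, hx⟩)
  rwa [le_div_iff₀ (by positivity)]

lemma exists_mem_dotProduct_mulVec_eq {ι : Type*} [Fintype ι] {A : Matrix ι ι ℝ} (hA : A.IsSymm)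
    {W : Submodule ℝ (ι → ℝ)} {g : ι → ℝ} (hgW : g ∈ W) (hg : g ≠ 0) {μ : ℝ}
    (hle : μ * (g ⬝ᵥ g) ≤ g ⬝ᵥ A *ᵥ g) :
    ∃ Λ, μ ≤ Λ ∧ ∃ h ∈ W, h ≠ 0 ∧ ∀ k ∈ W, k ⬝ᵥ A *ᵥ h = Λ * (k ⬝ᵥ h) := by
  classical
  let W' : Submodule ℝ (EuclideanSpace ℝ ι) :=
    W.comap (WithLp.linearEquiv 2 ℝ (ι → ℝ)).toLinearMap
  let T : W' →ₗ[ℝ] W' := W'.subtype.adjoint ∘ₗ toEuclideanLin A ∘ₗ W'.subtype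
  have hinner : ∀ x y : EuclideanSpace ℝ ι, inner ℝ x y = y.ofLp ⬝ᵥ x.ofLp := fun x y => rfl
  have hT : ∀ x y : W', inner ℝ (T x) y = y.1.ofLp ⬝ᵥ A *ᵥ x.1.ofLp := fun x y => by
    simp [T, LinearMap.adjoint_inner_left, hinner]
  have hsymm : T.IsSymmetric := fun x y => by
    rw [hT, real_inner_comm, hT, dotProduct_mulVec, ← mulVec_transpose, hA, dotProduct_comm]
  obtain ⟨Λ, hΛ, heig⟩ := exists_hasEigenvalue_ge hsymm (x := ⟨WithLp.toLp 2 g, hgW⟩)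
    (fun h0 => hg (congrArg (fun y : W' => y.1.ofLp) h0)) (μ := μ) (by
      rw [hT, ← real_inner_self_eq_norm_sq]
      exact hle)
  obtain ⟨h, hh⟩ := heig.exists_hasEigenvector
  refine ⟨Λ, hΛ, h.1.ofLp, h.2,
    fun h0 => hh.2 (Subtype.ext (PiLp.ext (congrFun h0))), fun k hk => ?_⟩
  have hTk := hT h ⟨WithLp.toLp 2 k, hk⟩
  rw [hh.apply_eq_smul, real_inner_smul_left] at hTk
  exact hTk.symm

end Spectral

section Potential

open Matrix

variable {V : Type*} {G : SimpleGraph V}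

/-- The matrix `-d(v, w) / 2`. On a tree it inverts the Laplacian on charges of total mass zero,
see `graphLaplacian_potential`. -/
noncomputable def greenMatrix (G : SimpleGraph V) : Matrix V V ℝ :=
  .of fun v w => -(G.dist v w : ℝ) / 2

lemma isSymm_greenMatrix : (greenMatrix G).IsSymm := by
  ext v w
  simp [greenMatrix, G.dist_comm]

variable [Fintype V]

/-- The potential `-½ ∑ₓ d(·, x) g x` of a charge `g`. -/
noncomputable def potential (G : SimpleGraph V) (g : V → ℝ) : V → ℝ :=
  greenMatrix G *ᵥ g

/-- The electrostatic energy of a charge `g`. On a tree, if `g` has total mass zero, it is the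
squared norm of the flow along the edges whose divergence is `g`. -/
noncomputable def flowEnergy (G : SimpleGraph V) (g : V → ℝ) : ℝ :=
  g ⬝ᵥ potential G g

/-- The charges of total mass zero that are carried by the leaves. -/
def leafCharges (G : SimpleGraph V) : Submodule ℝ (V → ℝ) where
  carrier := {g | (∀ v, ¬ IsLeaf G v → g v = 0) ∧ ∑ v, g v = 0}
  add_mem' hg hh :=
    ⟨fun v hv => by simp [hg.1 v hv, hh.1 v hv], by simp [sum_add_distrib, hg.2, hh.2]⟩
  zero_mem' := by simp
  smul_mem' c g hg := ⟨fun v hv => by simp [hg.1 v hv], by simp [← mul_sum, hg.2]⟩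

lemma potential_apply (g : V → ℝ) (v : V) :
    potential G g v = -(1 / 2) * ∑ x, (G.dist v x : ℝ) * g x := by
  rw [potential, mulVec, dotProduct, mul_sum]
  exact sum_congr rfl fun x _ => by rw [greenMatrix, of_apply]; ring

lemma flowEnergy_eq_sum (g : V → ℝ) :
    flowEnergy G g = -(1 / 2) * ∑ x, ∑ y, g x * g y * G.dist x y := by
  rw [flowEnergy, dotProduct, mul_sum]
  refine sum_congr rfl fun x _ => ?_
  rw [potential_apply, mul_left_comm, mul_sum]
  exact congrArg _ (sum_congr rfl fun y _ => by ring)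

lemma single_sub_single_mem_leafCharges [DecidableEq V] {x y : V} (hx : IsLeaf G x)
    (hy : IsLeaf G y) : (Pi.single x 1 - Pi.single y 1 : V → ℝ) ∈ leafCharges G := by
  refine ⟨fun v hv => ?_, by simp [sum_sub_distrib]⟩
  have hvx : v ≠ x := by rintro rfl; exact hv hx
  have hvy : v ≠ y := by rintro rfl; exact hv hy
  simp [hvx, hvy]

lemma flowEnergy_single_sub_single [DecidableEq V] (x y : V) :
    flowEnergy G (Pi.single x 1 - Pi.single y 1) = G.dist x y := by
  simp only [flowEnergy, potential, mulVec_sub, sub_dotProduct, mulVec_single_one,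
    single_one_dotProduct, Pi.sub_apply, col_apply, greenMatrix, of_apply, G.dist_self,
    G.dist_comm (u := y)]
  ring

open Classical in
lemma graphLaplacian_eq_lapMatrix_mulVec (f : V → ℝ) :
    graphLaplacian G f = G.lapMatrix ℝ *ᵥ f := by
  ext v
  rw [lapMatrix_mulVec_apply, graphLaplacian, neighborFinset_eq_filter, sum_sub_distrib, sum_const,
    nsmul_eq_mul, ← card_neighborFinset_eq_degree, neighborFinset_eq_filter]

lemma dotProduct_graphLaplacian (f h : V → ℝ) :
    f ⬝ᵥ graphLaplacian G h = graphLaplacian G f ⬝ᵥ h := by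
  classical
  rw [graphLaplacian_eq_lapMatrix_mulVec, graphLaplacian_eq_lapMatrix_mulVec, dotProduct_mulVec,
    ← mulVec_transpose, isSymm_lapMatrix]

lemma sum_graphLaplacian (f : V → ℝ) : ∑ v, graphLaplacian G f v = 0 := by
  have h := dotProduct_graphLaplacian (G := G) 1 f
  rwa [one_dotProduct, show graphLaplacian G (1 : V → ℝ) = 0 from
    funext fun v => by simp [graphLaplacian], zero_dotProduct] at h

lemma eq_of_graphLaplacian_eq_zero (hG : G.Connected) {f : V → ℝ} (hf : graphLaplacian G f = 0)
    (x y : V) : f x = f y := by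
  classical
  rw [graphLaplacian_eq_lapMatrix_mulVec] at hf
  exact (lapMatrix_mulVec_eq_zero_iff_forall_reachable _).mp hf x y (hG x y)

lemma graphLaplacian_of_isLeaf (f : V → ℝ) {ω ω' : V} (hω : IsLeaf G ω) (hadj : G.Adj ω ω') :
    graphLaplacian G f ω = f ω - f ω' := by
  classical
  have hfilter : univ.filter (fun w => G.Adj ω w) = {ω'} := by
    ext w
    simp only [mem_filter_univ, mem_singleton]
    exact ⟨fun hw => hω.unique hw hadj, fun hw => hw ▸ hadj⟩
  rw [graphLaplacian]
  convert sum_singleton (fun w => f ω - f w) ω'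

open Classical in
lemma graphLaplacian_dist (hG : G.IsTree) (x v : V) :
    graphLaplacian G (fun w => (G.dist w x : ℝ)) v = (if v = x then 0 else 2) - G.degree v := by
  have hdeg : (G.degree v : ℝ) = ∑ w with G.Adj v w, 1 := by
    rw [← card_neighborFinset_eq_degree, neighborFinset_eq_filter, sum_const, nsmul_one]
  rw [graphLaplacian, hdeg]
  split_ifs with hvx
  · subst hvx
    rw [zero_sub, ← sum_neg_distrib]
    refine sum_congr rfl fun w hw => ?_
    rw [G.dist_self, G.dist_comm, dist_eq_one_iff_adj.mpr (mem_filter.mp hw).2]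
    norm_num
  · obtain ⟨w₀, hw₀, hd⟩ := exists_adj_dist_add_one_eq hG.connected hvx
    have hterm : ∀ w, G.Adj v w →
        (G.dist v x : ℝ) - G.dist w x = (if w = w₀ then 2 else 0) - 1 := by
      intro w hw
      rw [G.dist_comm, G.dist_comm (u := w)]
      split_ifs with hww₀
      · rw [hww₀, ← hd]; push_cast; ring
      · rw [dist_eq_add_one_of_adj_of_ne hG hw₀ hw hd hww₀]; push_cast; ring
    rw [sum_congr rfl fun w hw => hterm w (mem_filter.mp hw).2, sum_sub_distrib]
    simp [hw₀]

lemma graphLaplacian_potential (hG : G.IsTree) {g : V → ℝ} (hg : ∑ v, g v = 0) :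
    graphLaplacian G (potential G g) = g := by
  classical
  ext v
  calc graphLaplacian G (potential G g) v
      = -(1 / 2) * ∑ x, graphLaplacian G (fun w => (G.dist w x : ℝ)) v * g x := by
        simp only [graphLaplacian, potential_apply, sum_mul, mul_sum]
        rw [sum_comm]
        exact sum_congr rfl fun w _ => by
          rw [← sum_sub_distrib]
          exact sum_congr rfl fun x _ => by ring
    _ = -(1 / 2) * ∑ x, ((2 - (G.degree v : ℝ)) * g x - if v = x then 2 * g x else 0) := by
        congr 1
        refine sum_congr rfl fun x _ => ?_
        rw [graphLaplacian_dist hG]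
        split_ifs <;> ring
    _ = g v := by
        rw [sum_sub_distrib, ← mul_sum, hg, sum_ite_eq, if_pos (mem_univ v)]
        ring

lemma isSteklovEigenvalue_inv_of_isCritical (hG : G.IsTree) {h : V → ℝ} (hh : h ∈ leafCharges G)
    (h0 : h ≠ 0) {Λ : ℝ} (hΛ : 0 < Λ)
    (hcrit : ∀ k ∈ leafCharges G, k ⬝ᵥ potential G h = Λ * (k ⬝ᵥ h)) :
    IsSteklovEigenvalue G Λ⁻¹ := by
  classical
  obtain ⟨x, hx⟩ := Function.ne_iff.mp h0
  have hleaf : IsLeaf G x := by_contra fun hx' => hx (hh.1 x hx')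
  set c := Λ * h x - potential G h x with hc
  have hconst : ∀ y, IsLeaf G y → potential G h y + c = Λ * h y := by
    intro y hy
    have hxy := hcrit _ (single_sub_single_mem_leafCharges hleaf hy)
    simp only [sub_dotProduct, single_one_dotProduct] at hxy
    rw [hc]
    linarith
  refine ⟨by positivity, fun v => potential G h v + c, ?_, fun v hv => ?_, fun ω ω' hω hadj => ?_⟩
  · intro hzero
    have := congrFun hzero x
    rw [hconst x hleaf] at this
    exact mul_ne_zero hΛ.ne' hx this
  · have := congrFun (graphLaplacian_potential hG hh.2) v
    rw [hh.1 v hv] at this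
    simpa [graphLaplacian] using this
  · have := congrFun (graphLaplacian_potential hG hh.2) ω
    rw [graphLaplacian_of_isLeaf _ hω hadj] at this
    simp only [hconst ω hω, inv_mul_cancel_left₀ hΛ.ne']
    linarith [hconst ω hω]

lemma exists_isSteklovEigenvalue_le (hG : G.IsTree) {g : V → ℝ} (hg : g ∈ leafCharges G)
    (hg0 : g ≠ 0) {μ : ℝ} (hμ : 0 < μ) (hle : μ * (g ⬝ᵥ g) ≤ flowEnergy G g) :
    ∃ lam, 0 < lam ∧ lam ≤ μ⁻¹ ∧ IsSteklovEigenvalue G lam := by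
  obtain ⟨Λ, hΛ, h, hh, h0, hcrit⟩ := exists_mem_dotProduct_mulVec_eq isSymm_greenMatrix hg hg0 hle
  have hΛpos := hμ.trans_le hΛ
  exact ⟨Λ⁻¹, inv_pos.mpr hΛpos, inv_anti₀ hμ hΛ,
    isSteklovEigenvalue_inv_of_isCritical hG hh h0 hΛpos hcrit⟩

lemma steklovLambda₂_le_inv (hG : G.IsTree) {g : V → ℝ} (hg : g ∈ leafCharges G) (hg0 : g ≠ 0)
    {μ : ℝ} (hμ : 0 < μ) (hle : μ * (g ⬝ᵥ g) ≤ flowEnergy G g) : steklovLambda₂ G ≤ μ⁻¹ := by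
  obtain ⟨lam, hpos, hlam, heig⟩ := exists_isSteklovEigenvalue_le hG hg hg0 hμ hle
  have hbdd : BddBelow {lam | 0 < lam ∧ IsSteklovEigenvalue G lam} := ⟨0, fun _ hx => hx.1.le⟩
  exact (csInf_le hbdd ⟨hpos, heig⟩).trans hlam

lemma steklovLambda₂_lt_inv (hG : G.IsTree) {g : V → ℝ} (hg : g ∈ leafCharges G) (hg0 : g ≠ 0)
    {μ : ℝ} (hμ : 0 < μ) (hlt : μ * (g ⬝ᵥ g) < flowEnergy G g) : steklovLambda₂ G < μ⁻¹ := by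
  have hmass : 0 < g ⬝ᵥ g := by simpa using dotProduct_star_self_pos_iff.mpr hg0
  have hquot : μ < flowEnergy G g / (g ⬝ᵥ g) := (lt_div_iff₀ hmass).mpr hlt
  exact (steklovLambda₂_le_inv hG hg hg0 (hμ.trans hquot)
    (div_mul_cancel₀ _ hmass.ne').le).trans_lt (inv_strictAnti₀ hμ hquot)

lemma exists_isSteklovEigenvalue_pos [Nontrivial V] (hG : G.IsTree) :
    ∃ lam, 0 < lam ∧ IsSteklovEigenvalue G lam := by
  classical
  obtain ⟨x, y, hx, hy, hxy⟩ := exists_isLeaf_isLeaf_ne hG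
  have hd : (0 : ℝ) < G.dist x y := mod_cast hG.connected.pos_dist_of_ne hxy
  have hmass : (Pi.single x 1 - Pi.single y 1 : V → ℝ) ⬝ᵥ (Pi.single x 1 - Pi.single y 1) = 2 := by
    norm_num [hxy, hxy.symm]
  obtain ⟨lam, hpos, -, heig⟩ := exists_isSteklovEigenvalue_le hG
    (single_sub_single_mem_leafCharges hx hy) (by rintro h0; simp [h0] at hmass) (half_pos hd)
    (by rw [flowEnergy_single_sub_single, hmass, div_mul_cancel₀ _ two_ne_zero])
  exact ⟨lam, hpos, heig⟩

lemma inv_le_of_isSteklovEigenvalue [Nontrivial V] (hG : G.IsTree) {μ : ℝ}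
    (hmax : ∀ g ∈ leafCharges G, flowEnergy G g ≤ μ * (g ⬝ᵥ g)) {lam : ℝ} (hlam : 0 < lam)
    (heig : IsSteklovEigenvalue G lam) : μ⁻¹ ≤ lam := by
  obtain ⟨-, f, hf0, hint, hbd⟩ := heig
  set g := graphLaplacian G f with hg
  have hleaf : ∀ v, IsLeaf G v → g v = lam * f v := fun v hv => by
    obtain ⟨w, hw, -⟩ := id hv
    rw [hg, graphLaplacian_of_isLeaf f hv hw, hbd v w hv hw]
  have henergy : flowEnergy G g = f ⬝ᵥ g := by
    rw [flowEnergy, hg, ← dotProduct_graphLaplacian,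
      graphLaplacian_potential hG (sum_graphLaplacian f)]
  have hnorm : g ⬝ᵥ g = lam * (f ⬝ᵥ g) := by
    rw [dotProduct, dotProduct, mul_sum]
    refine sum_congr rfl fun v _ => ?_
    by_cases hv : IsLeaf G v
    · rw [hleaf v hv]; ring
    · rw [hint v hv]; ring
  have hg0 : g ≠ 0 := by
    intro hzero
    obtain ⟨x, hx⟩ := Function.ne_iff.mp hf0
    obtain ⟨w, hw⟩ := exists_ne x
    obtain ⟨y, hy, -⟩ := exists_isLeaf_isBetween hG hw
    have hfy := hleaf y hy
    rw [hzero, eq_of_graphLaplacian_eq_zero hG.connected hzero y x] at hfy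
    exact mul_ne_zero hlam.ne' hx hfy.symm
  have hle := hmax g ⟨hint, sum_graphLaplacian f⟩
  have hpos : 0 < g ⬝ᵥ g := by simpa using dotProduct_star_self_pos_iff.mpr hg0
  rw [henergy] at hle
  rw [hnorm] at hpos hle
  have hfg : 0 < f ⬝ᵥ g := pos_of_mul_pos_right hpos hlam.le
  have hμlam : 1 ≤ lam * μ := le_of_mul_le_mul_right (by linarith) hfg
  exact inv_le_of_inv_le₀ hlam ((inv_le_iff_one_le_mul₀' hlam).mpr hμlam)

lemma inv_le_steklovLambda₂ [Nontrivial V] (hG : G.IsTree) {μ : ℝ}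
    (hmax : ∀ g ∈ leafCharges G, flowEnergy G g ≤ μ * (g ⬝ᵥ g)) : μ⁻¹ ≤ steklovLambda₂ G :=
  le_csInf (exists_isSteklovEigenvalue_pos hG) fun _ hlam =>
    inv_le_of_isSteklovEigenvalue hG hmax hlam.1 hlam.2

end Potential

section Secular

/-- The total conductance `∑ 1 / (μ - ℓ)` of arms of the given lengths at spectral parameter
`1 / μ`. -/
noncomputable def conductance (A : Multiset ℕ) (μ : ℝ) : ℝ :=
  (A.map fun ℓ : ℕ => (μ - ℓ)⁻¹).sum

/-- The secular equation for `1 / λ₂` of the double spider with arm lengths `A` and `B`. The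
strict bounds keep all conductances away from the poles. -/
structure IsSecularRoot (A B : Multiset ℕ) (μ : ℝ) : Prop where
  lt_left : ∀ ℓ ∈ A, (ℓ : ℝ) < μ
  lt_right : ∀ ℓ ∈ B, (ℓ : ℝ) < μ
  inv_add_inv : (conductance A μ)⁻¹ + (conductance B μ)⁻¹ = 1

variable {A B : Multiset ℕ} {μ μ' : ℝ} {r : ℕ}

lemma conductance_cons (ℓ : ℕ) : conductance (ℓ ::ₘ A) μ = (μ - ℓ)⁻¹ + conductance A μ := by
  simp [conductance]

lemma conductance_add : conductance (A + B) μ = conductance A μ + conductance B μ := by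
  simp [conductance]

lemma conductance_nonneg (hA : ∀ ℓ ∈ A, (ℓ : ℝ) < μ) : 0 ≤ conductance A μ :=
  Multiset.sum_nonneg (by simpa using fun ℓ hℓ => (hA ℓ hℓ).le)

lemma inv_sub_le_conductance (hA : ∀ ℓ ∈ A, (ℓ : ℝ) < μ) {ℓ : ℕ} (hℓ : ℓ ∈ A) :
    (μ - ℓ)⁻¹ ≤ conductance A μ :=
  Multiset.single_le_sum (by simpa using fun ℓ hℓ => (hA ℓ hℓ).le) _
    (Multiset.mem_map_of_mem _ hℓ)

lemma conductance_pos (h0 : A ≠ 0) (hA : ∀ ℓ ∈ A, (ℓ : ℝ) < μ) : 0 < conductance A μ := by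
  obtain ⟨ℓ, hℓ⟩ := Multiset.exists_mem_of_ne_zero h0
  exact (inv_pos.mpr (sub_pos.mpr (hA ℓ hℓ))).trans_le (inv_sub_le_conductance hA hℓ)

lemma conductance_anti (hA : ∀ ℓ ∈ A, (ℓ : ℝ) < μ) (hle : μ ≤ μ') :
    conductance A μ' ≤ conductance A μ :=
  Multiset.sum_map_le_sum_map _ _ fun ℓ hℓ =>
    inv_anti₀ (sub_pos.mpr (hA ℓ hℓ)) (sub_le_sub_right hle _)

lemma conductance_le (hA : ∀ ℓ ∈ A, ℓ ≤ r) (hμ : r < μ) :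
    conductance A μ ≤ A.card * (μ - r)⁻¹ := by
  rw [← nsmul_eq_mul, ← Multiset.card_map fun ℓ : ℕ => (μ - ℓ)⁻¹]
  refine Multiset.sum_le_card_nsmul _ _ ?_
  simp only [Multiset.mem_map, forall_exists_index, and_imp, forall_apply_eq_imp_iff₂]
  intro ℓ hℓ
  have : (ℓ : ℝ) ≤ r := mod_cast hA ℓ hℓ
  exact inv_anti₀ (sub_pos.mpr hμ) (by linarith)

lemma continuousOn_conductance (hA : ∀ ℓ ∈ A, ℓ ≤ r) :
    ContinuousOn (conductance A) (Set.Ioi (r : ℝ)) := by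
  induction A using Multiset.induction_on with
  | empty => exact (continuousOn_const (c := (0 : ℝ))).congr fun μ _ => by simp [conductance]
  | cons ℓ A ih =>
    rw [Multiset.forall_mem_cons] at hA
    have hℓ : (ℓ : ℝ) ≤ r := mod_cast hA.1
    refine ((ContinuousOn.inv₀ (by fun_prop) fun μ hμ => ?_).add (ih hA.2)).congr
      fun μ _ => conductance_cons ℓ
    exact (sub_pos.mpr (hℓ.trans_lt hμ)).ne'

lemma inv_conductance_add_half_le (hA : ∀ ℓ ∈ A, ℓ ≤ r) (hr : r ∈ A) :
    (conductance A (r + 1 / 2))⁻¹ ≤ 1 / 2 := by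
  have hlt : ∀ ℓ ∈ A, (ℓ : ℝ) < r + 1 / 2 := fun ℓ hℓ => by
    have : (ℓ : ℝ) ≤ r := mod_cast hA ℓ hℓ
    linarith
  refine inv_le_of_inv_le₀ one_half_pos ?_
  simpa using inv_sub_le_conductance hlt hr

lemma one_le_inv_conductance_add_card (h0 : A ≠ 0) (hA : ∀ ℓ ∈ A, ℓ ≤ r) :
    1 ≤ (conductance A (r + A.card))⁻¹ := by
  have hcard : (0 : ℝ) < A.card := mod_cast Multiset.card_pos.mpr h0
  have hlt : (r : ℝ) < r + A.card := lt_add_of_pos_right _ hcard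
  refine (one_le_inv₀ (conductance_pos h0 fun ℓ hℓ => ?_)).mpr ((conductance_le hA hlt).trans ?_)
  · exact lt_of_le_of_lt (mod_cast hA ℓ hℓ) hlt
  · rw [add_sub_cancel_left, mul_inv_cancel₀ hcard.ne']

lemma exists_isSecularRoot (hA : ∀ ℓ ∈ A, ℓ ≤ r) (hB : ∀ ℓ ∈ B, ℓ ≤ r) (hrA : r ∈ A)
    (hrB : r ∈ B) : ∃ μ, IsSecularRoot A B μ := by
  have h0 : ∀ {C : Multiset ℕ}, r ∈ C → C ≠ 0 := by rintro _ h rfl; simp at h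
  have hlt : ∀ {C : Multiset ℕ}, (∀ ℓ ∈ C, ℓ ≤ r) → ∀ {μ : ℝ}, r < μ → ∀ ℓ ∈ C, (ℓ : ℝ) < μ :=
    fun hC _ hμ ℓ hℓ => lt_of_le_of_lt (mod_cast hC ℓ hℓ) hμ
  have hcont : ∀ {C : Multiset ℕ}, r ∈ C → (∀ ℓ ∈ C, ℓ ≤ r) →
      ContinuousOn (fun μ => (conductance C μ)⁻¹) (Set.Ioi (r : ℝ)) := fun hrC hC =>
    (continuousOn_conductance hC).inv₀ fun _ hμ => (conductance_pos (h0 hrC) (hlt hC hμ)).ne'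
  have hcard : (1 : ℝ) ≤ A.card := mod_cast Multiset.card_pos.mpr (h0 hrA)
  have hsub : Set.Icc ((r : ℝ) + 1 / 2) (r + A.card) ⊆ Set.Ioi (r : ℝ) := fun μ hμ =>
    lt_of_lt_of_le (by linarith) hμ.1
  have hlow := add_le_add (inv_conductance_add_half_le hA hrA) (inv_conductance_add_half_le hB hrB)
  have hhigh := add_le_add (one_le_inv_conductance_add_card (h0 hrA) hA)
    (inv_nonneg.mpr (conductance_nonneg (hlt hB (μ := r + A.card) (by linarith))))
  obtain ⟨μ, hμ, hroot⟩ := intermediate_value_Icc (by linarith)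
    (((hcont hrA hA).add (hcont hrB hB)).mono hsub)
    ⟨hlow.trans_eq (add_halves 1), (add_zero (1 : ℝ)).symm.trans_le hhigh⟩
  exact ⟨μ, hlt hA (hsub hμ), hlt hB (hsub hμ), hroot⟩

lemma IsSecularRoot.pos (hμ : IsSecularRoot A B μ) (h0 : A ≠ 0) : 0 < μ := by
  obtain ⟨ℓ, hℓ⟩ := Multiset.exists_mem_of_ne_zero h0
  exact (Nat.cast_nonneg ℓ).trans_lt (hμ.lt_left ℓ hℓ)

lemma inv_add_inv_lt_of_transfer {s m t : ℝ} (hm : 0 < m) (hms : m < s) (ht : 0 < t) :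
    s⁻¹ + (m + t)⁻¹ < (s + t)⁻¹ + m⁻¹ := by
  have hs : 0 < s := hm.trans hms
  rw [inv_add_inv hs.ne' (by positivity), inv_add_inv (by positivity) hm.ne',
    add_right_comm s t m, ← add_assoc]
  refine div_lt_div_of_pos_left (by positivity) (by positivity) ?_
  nlinarith

lemma IsSecularRoot.lt_of_transfer (hA : A ≠ 0) (hB : B ≠ 0)
    (hμ : IsSecularRoot (r ::ₘ A) (r ::ₘ B) μ) (hμ' : IsSecularRoot (r ::ₘ A + B) {r} μ') :
    μ' < μ := by
  obtain ⟨hr, hltA⟩ := Multiset.forall_mem_cons.mp hμ.lt_left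
  obtain ⟨-, hltB⟩ := Multiset.forall_mem_cons.mp hμ.lt_right
  have hpos := inv_add_inv_lt_of_transfer (inv_pos.mpr (sub_pos.mpr hr))
    (lt_add_of_pos_right _ (conductance_pos hA hltA)) (conductance_pos hB hltB)
  by_contra! hle
  have hleft : ∀ ℓ ∈ r ::ₘ A + B, (ℓ : ℝ) < μ := fun ℓ hℓ =>
    (Multiset.mem_add.mp hℓ).elim (hμ.lt_left ℓ) (hltB ℓ)
  have hright : ∀ ℓ ∈ ({r} : Multiset ℕ), (ℓ : ℝ) < μ := by simpa using hr
  have hinv := add_le_add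
    (inv_anti₀ (conductance_pos (by simp) hμ'.lt_left) (conductance_anti hleft hle))
    (inv_anti₀ (conductance_pos (by simp) hμ'.lt_right) (conductance_anti hright hle))
  have hroot := hμ.inv_add_inv
  have hsingle : conductance {r} μ = (μ - r)⁻¹ := by simp [conductance]
  rw [hμ'.inv_add_inv, conductance_add, conductance_cons, hsingle] at hinv
  rw [conductance_cons, conductance_cons] at hroot
  linarith

end Secular

section Sides

variable {V : Type*} {G : SimpleGraph V} {u v w x y : V}

/-- The vertices on the `u`-side of an edge `uv`. -/
def side (G : SimpleGraph V) (u v : V) : Set V :=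
  {x | G.dist v x = G.dist u x + 1}

lemma mem_side : x ∈ side G u v ↔ G.dist v x = G.dist u x + 1 := Iff.rfl

lemma compl_side (hG : G.IsTree) (huv : G.Adj u v) : (side G u v)ᶜ = side G v u := by
  ext x
  have := hG.dist_eq_dist_add_one_of_adj x huv
  simp only [Set.mem_compl_iff, mem_side, G.dist_comm (v := x)]
  omega

lemma dist_eq_of_mem_side_of_mem_side (hG : G.IsTree) (huv : G.Adj u v) (hx : x ∈ side G u v)
    (hy : y ∈ side G v u) : G.dist x y = G.dist u x + 1 + G.dist v y := by
  rw [mem_side] at hx hy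
  have huv1 : G.dist u v = 1 := dist_eq_one_iff_adj.mpr huv
  rw [dist_eq_of_isBetween_of_isBetween hG huv.ne (z := y) (x := x), dist_comm, hy]
  · ring
  · rw [IsBetween, G.dist_comm (u := x), G.dist_comm (u := x), hx, huv1]
  · rw [IsBetween, huv1, hy, add_comm]

/-- The Gromov product: in a tree, the length shared by the paths from `u` to `x` and to `y`. -/
noncomputable def gromovProduct (G : SimpleGraph V) (u x y : V) : ℝ :=
  (G.dist u x + G.dist u y - G.dist x y) / 2

lemma gromovProduct_self : gromovProduct G u x x = G.dist u x := by
  simp [gromovProduct]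

lemma gromovProduct_nonneg (hG : G.Connected) : 0 ≤ gromovProduct G u x y := by
  have : (G.dist x y : ℝ) ≤ G.dist u x + G.dist u y := by
    rw [G.dist_comm (u := u)]
    exact_mod_cast hG.dist_triangle
  exact div_nonneg (sub_nonneg.mpr this) two_pos.le

variable [Fintype V]

open Classical in
/-- The leaves on the `u`-side of an edge `uv`. -/
noncomputable def sideLeaves (G : SimpleGraph V) (u v : V) : Finset V :=
  {x | IsLeaf G x ∧ x ∈ side G u v}

lemma mem_sideLeaves : x ∈ sideLeaves G u v ↔ IsLeaf G x ∧ x ∈ side G u v := by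
  simp [sideLeaves]

lemma disjoint_sideLeaves : Disjoint (sideLeaves G u v) (sideLeaves G v u) := by
  simp only [Finset.disjoint_left, mem_sideLeaves, mem_side]
  omega

lemma sideLeaves_nonempty (hG : G.IsTree) (huv : G.Adj u v) : (sideLeaves G u v).Nonempty := by
  obtain ⟨x, hx, hux⟩ := exists_isLeaf_isBetween hG huv.ne
  rw [IsBetween, dist_eq_one_iff_adj.mpr huv.symm, add_comm] at hux
  exact ⟨x, mem_sideLeaves.mpr ⟨hx, hux.symm⟩⟩

lemma sum_eq_sum_sideLeaves_add (hG : G.IsTree) (huv : G.Adj u v) {f : V → ℝ}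
    (hf : ∀ x, ¬ IsLeaf G x → f x = 0) :
    ∑ x, f x = ∑ x ∈ sideLeaves G u v, f x + ∑ y ∈ sideLeaves G v u, f y := by
  classical
  rw [← sum_union disjoint_sideLeaves]
  refine (sum_subset (subset_univ _) fun x _ hx => hf x fun hleaf => hx ?_).symm
  rw [mem_union, mem_sideLeaves, mem_sideLeaves, ← compl_side hG huv, Set.mem_compl_iff]
  tauto

/-- No two leaves on the `u`-side of the edge `uv` share an edge of their paths to `u`. -/
def IsUnbranched (G : SimpleGraph V) (u v : V) : Prop :=
  (sideLeaves G u v : Set V).Pairwise fun x y => G.dist x y = G.dist u x + G.dist u y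

/-- The contribution to the flow energy of the edges on the `u`-side of the edge `uv`. -/
noncomputable def sideEnergy (G : SimpleGraph V) (u v : V) (g : V → ℝ) : ℝ :=
  ∑ x ∈ sideLeaves G u v, ∑ y ∈ sideLeaves G u v, g x * g y * gromovProduct G u x y

lemma sum_sum_mul_dist_eq_of_side (g : V → ℝ) :
    ∑ x ∈ sideLeaves G u v, ∑ y ∈ sideLeaves G u v, g x * g y * (G.dist x y : ℝ) =
      2 * (∑ x ∈ sideLeaves G u v, g x * G.dist u x) * ∑ x ∈ sideLeaves G u v, g x -
        2 * sideEnergy G u v g := by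
  have hterm : ∀ x y, g x * g y * (G.dist x y : ℝ) = g x * G.dist u x * g y +
      g x * (g y * G.dist u y) - 2 * (g x * g y * gromovProduct G u x y) := fun x y => by
    rw [gromovProduct]; ring
  simp_rw [hterm, sum_sub_distrib, sum_add_distrib, ← mul_sum, ← sum_mul, sideEnergy]
  ring

lemma sum_sum_mul_dist_eq_of_sides (hG : G.IsTree) (huv : G.Adj u v) (g : V → ℝ) :
    ∑ x ∈ sideLeaves G u v, ∑ y ∈ sideLeaves G v u, g x * g y * (G.dist x y : ℝ) =
      (∑ x ∈ sideLeaves G u v, g x * G.dist u x + ∑ x ∈ sideLeaves G u v, g x) *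
          ∑ y ∈ sideLeaves G v u, g y +
        (∑ x ∈ sideLeaves G u v, g x) * ∑ y ∈ sideLeaves G v u, g y * G.dist v y := by
  simp_rw [← sum_add_distrib, sum_mul_sum, ← sum_add_distrib]
  refine sum_congr rfl fun x hx => sum_congr rfl fun y hy => ?_
  rw [dist_eq_of_mem_side_of_mem_side hG huv (mem_sideLeaves.mp hx).2 (mem_sideLeaves.mp hy).2]
  push_cast
  ring

lemma flowEnergy_eq_sq_add_sideEnergy (hG : G.IsTree) (huv : G.Adj u v) {g : V → ℝ}
    (hg : g ∈ leafCharges G) : flowEnergy G g =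
      (∑ x ∈ sideLeaves G u v, g x) ^ 2 + sideEnergy G u v g + sideEnergy G v u g := by
  have hsum := sum_eq_sum_sideLeaves_add hG huv hg.1
  rw [hg.2] at hsum
  rw [flowEnergy_eq_sum, sum_eq_sum_sideLeaves_add hG huv fun x hx => by simp [hg.1 x hx]]
  have hrow : ∀ x, ∑ y, g x * g y * (G.dist x y : ℝ) =
      ∑ y ∈ sideLeaves G u v, g x * g y * (G.dist x y : ℝ) +
        ∑ y ∈ sideLeaves G v u, g x * g y * (G.dist x y : ℝ) := fun x =>
    sum_eq_sum_sideLeaves_add hG huv fun y hy => by simp [hg.1 y hy]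
  simp_rw [hrow, sum_add_distrib, sum_sum_mul_dist_eq_of_side,
    sum_sum_mul_dist_eq_of_sides hG huv, sum_sum_mul_dist_eq_of_sides hG huv.symm]
  rw [eq_neg_of_add_eq_zero_right hsum.symm]
  ring

lemma sideEnergy_eq_of_isUnbranched (h : IsUnbranched G u v) (g : V → ℝ) :
    sideEnergy G u v g = ∑ x ∈ sideLeaves G u v, G.dist u x * g x ^ 2 := by
  refine sum_congr rfl fun x hx => ?_
  rw [sum_eq_single_of_mem x hx fun y hy hne => ?_, gromovProduct_self]
  · ring
  · rw [gromovProduct, h hx hy hne.symm]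
    simp

/-- `uv` is the middle edge of a longest path of length `2 * r + 1`; by `IsCentralEdge.diam_eq` it
suffices to bound the depths of leaves. -/
structure IsCentralEdge (G : SimpleGraph V) (r : ℕ) (u v : V) : Prop where
  adj : G.Adj u v
  dist_le_left : ∀ x ∈ sideLeaves G u v, G.dist u x ≤ r
  dist_le_right : ∀ y ∈ sideLeaves G v u, G.dist v y ≤ r
  exists_left : ∃ x ∈ sideLeaves G u v, G.dist u x = r
  exists_right : ∃ y ∈ sideLeaves G v u, G.dist v y = r

lemma IsCentralEdge.symm {r : ℕ} (h : IsCentralEdge G r u v) : IsCentralEdge G r v u :=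
  ⟨h.adj.symm, h.dist_le_right, h.dist_le_left, h.exists_right, h.exists_left⟩

lemma IsCentralEdge.dist_le_of_isLeaf (hG : G.IsTree) {r : ℕ} (h : IsCentralEdge G r u v)
    (hx : IsLeaf G x) :
    G.dist u x ≤ r ∧ G.dist v x = G.dist u x + 1 ∨
      G.dist v x ≤ r ∧ G.dist u x = G.dist v x + 1 := by
  by_cases hside : x ∈ side G u v
  · exact .inl ⟨h.dist_le_left x (mem_sideLeaves.mpr ⟨hx, hside⟩), hside⟩
  · rw [← Set.mem_compl_iff, compl_side hG h.adj] at hside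
    exact .inr ⟨h.dist_le_right x (mem_sideLeaves.mpr ⟨hx, hside⟩), hside⟩

lemma IsCentralEdge.diam_eq (hG : G.IsTree) {r : ℕ} (h : IsCentralEdge G r u v) :
    G.diam = 2 * r + 1 := by
  have := hG.connected.nonempty
  apply le_antisymm
  · obtain ⟨x, y, hxy⟩ := G.exists_dist_eq_diam
    have hne : x ≠ y := by
      rintro rfl
      have := dist_le_diam_of_connected hG.connected u v
      rw [dist_eq_one_iff_adj.mpr h.adj, ← hxy, G.dist_self] at this
      omega
    have hx := h.dist_le_of_isLeaf hG (isLeaf_of_dist_eq_diam hG hne hxy)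
    have hy := h.dist_le_of_isLeaf hG (isLeaf_of_dist_eq_diam hG hne.symm (by rwa [dist_comm]))
    have htriu := hG.connected.dist_triangle (u := x) (v := u) (w := y)
    have htriv := hG.connected.dist_triangle (u := x) (v := v) (w := y)
    rw [G.dist_comm (u := x) (v := u)] at htriu
    rw [G.dist_comm (u := x) (v := v)] at htriv
    omega
  · obtain ⟨x, hx, hxr⟩ := h.exists_left
    obtain ⟨y, hy, hyr⟩ := h.exists_right
    have := dist_le_diam_of_connected hG.connected x y
    rw [dist_eq_of_mem_side_of_mem_side hG h.adj (mem_sideLeaves.mp hx).2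
      (mem_sideLeaves.mp hy).2, hxr, hyr] at this
    omega

end Sides

section ArmCharge

variable {V : Type*} {X : Finset V} {ℓ : V → ℕ} {μ : ℝ}

lemma conductance_map_val : conductance (X.val.map ℓ) μ = ∑ x ∈ X, (μ - ℓ x)⁻¹ := by
  rw [conductance, Multiset.map_map]
  rfl

lemma sum_sq_mul_inv_conductance_le (hX : X.Nonempty) (hμ : ∀ x ∈ X, (ℓ x : ℝ) < μ) (g : V → ℝ) :
    (∑ x ∈ X, g x) ^ 2 * (conductance (X.val.map ℓ) μ)⁻¹ ≤ ∑ x ∈ X, (μ - ℓ x) * g x ^ 2 := by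
  have hpos : ∀ x ∈ X, 0 < μ - ℓ x := fun x hx => sub_pos.mpr (hμ x hx)
  rw [conductance_map_val, ← div_eq_mul_inv,
    div_le_iff₀ (sum_pos (fun x hx => inv_pos.mpr (hpos x hx)) hX)]
  refine sum_sq_le_sum_mul_sum_of_sq_le_mul X (fun x hx => ?_)
    (fun x hx => (inv_pos.mpr (hpos x hx)).le) fun x hx => ?_
  · exact mul_nonneg (hpos x hx).le (sq_nonneg _)
  · rw [mul_right_comm, mul_inv_cancel₀ (hpos x hx).ne', one_mul]

lemma IsSecularRoot.symm {A B : Multiset ℕ} (hμ : IsSecularRoot A B μ) : IsSecularRoot B A μ :=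
  ⟨hμ.lt_right, hμ.lt_left, (add_comm _ _).trans hμ.inv_add_inv⟩

lemma IsSecularRoot.lt_of_mem {B : Multiset ℕ} (hμ : IsSecularRoot (X.val.map ℓ) B μ) :
    ∀ x ∈ X, (ℓ x : ℝ) < μ :=
  fun _ hx => hμ.lt_left _ (Multiset.mem_map_of_mem _ hx)

open Classical in
/-- The unit charge on the arm ends `X` attaining equality in `sum_sq_mul_inv_conductance_le`. -/
noncomputable def armCharge (X : Finset V) (ℓ : V → ℕ) (μ : ℝ) (x : V) : ℝ :=
  if x ∈ X then (conductance (X.val.map ℓ) μ)⁻¹ * (μ - ℓ x)⁻¹ else 0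

lemma armCharge_of_notMem {x : V} (hx : x ∉ X) : armCharge X ℓ μ x = 0 :=
  if_neg hx

lemma armCharge_pos (hμ : ∀ x ∈ X, (ℓ x : ℝ) < μ) {x : V} (hx : x ∈ X) :
    0 < armCharge X ℓ μ x := by
  rw [armCharge, if_pos hx, conductance_map_val]
  have hpos : ∀ x ∈ X, 0 < (μ - ℓ x)⁻¹ := fun x hx => inv_pos.mpr (sub_pos.mpr (hμ x hx))
  exact mul_pos (inv_pos.mpr (sum_pos hpos ⟨x, hx⟩)) (hpos x hx)

lemma sum_armCharge (hX : X.Nonempty) (hμ : ∀ x ∈ X, (ℓ x : ℝ) < μ) :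
    ∑ x ∈ X, armCharge X ℓ μ x = 1 := by
  have hpos : 0 < ∑ x ∈ X, (μ - ℓ x)⁻¹ :=
    sum_pos (fun x hx => inv_pos.mpr (sub_pos.mpr (hμ x hx))) hX
  simp only [armCharge]
  rw [sum_congr rfl fun x hx => if_pos hx, ← mul_sum, conductance_map_val,
    inv_mul_cancel₀ hpos.ne']

lemma sum_mul_armCharge_sq (hX : X.Nonempty) (hμ : ∀ x ∈ X, (ℓ x : ℝ) < μ) :
    ∑ x ∈ X, (μ - ℓ x) * armCharge X ℓ μ x ^ 2 = (conductance (X.val.map ℓ) μ)⁻¹ := by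
  rw [← mul_one (conductance _ _)⁻¹, ← sum_armCharge hX hμ, mul_sum]
  refine sum_congr rfl fun x hx => ?_
  have := (sub_pos.mpr (hμ x hx)).ne'
  rw [armCharge, if_pos hx]
  field_simp

end ArmCharge

section Comparison

variable {V : Type*} {G : SimpleGraph V} {u v : V} {ℓ ℓ' : V → ℕ} {μ : ℝ} {g : V → ℝ}

lemma mul_sq_le_mul_gromovProduct {x : V} (hℓ : ℓ x ≤ G.dist u x) :
    ℓ x * g x ^ 2 ≤ g x * g x * gromovProduct G u x x := by
  rw [gromovProduct_self, mul_comm, sq]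
  exact mul_le_mul_of_nonneg_left (mod_cast hℓ) (mul_self_nonneg _)

variable [Fintype V]

lemma mul_sq_le_sum_gromovProduct (hG : G.Connected)
    (hg : ∀ x ∈ sideLeaves G u v, ∀ y ∈ sideLeaves G u v, 0 < g x * g y) {x : V}
    (hx : x ∈ sideLeaves G u v) (hℓ : ℓ x ≤ G.dist u x) :
    ℓ x * g x ^ 2 ≤ ∑ y ∈ sideLeaves G u v, g x * g y * gromovProduct G u x y :=
  (mul_sq_le_mul_gromovProduct hℓ).trans
    (single_le_sum (f := fun y => g x * g y * gromovProduct G u x y)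
      (fun y hy => mul_nonneg (hg x hx y hy).le (gromovProduct_nonneg hG)) hx)

lemma sum_mul_sq_le_sideEnergy (hG : G.Connected)
    (hg : ∀ x ∈ sideLeaves G u v, ∀ y ∈ sideLeaves G u v, 0 < g x * g y)
    (hℓ : ∀ x ∈ sideLeaves G u v, ℓ x ≤ G.dist u x) :
    ∑ x ∈ sideLeaves G u v, ℓ x * g x ^ 2 ≤ sideEnergy G u v g :=
  sum_le_sum fun x hx => mul_sq_le_sum_gromovProduct hG hg hx (hℓ x hx)

lemma sum_mul_sq_lt_sideEnergy (hG : G.Connected)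
    (hg : ∀ x ∈ sideLeaves G u v, ∀ y ∈ sideLeaves G u v, 0 < g x * g y)
    (hℓ : ∀ x ∈ sideLeaves G u v, ℓ x ≤ G.dist u x) (hbr : ¬ IsUnbranched G u v) :
    ∑ x ∈ sideLeaves G u v, ℓ x * g x ^ 2 < sideEnergy G u v g := by
  simp only [IsUnbranched, Set.Pairwise, not_forall, mem_coe] at hbr
  obtain ⟨x, hx, y, hy, hne, hxy⟩ := hbr
  refine sum_lt_sum (fun z hz => mul_sq_le_sum_gromovProduct hG hg hz (hℓ z hz)) ⟨x, hx, ?_⟩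
  have hshared : 0 < gromovProduct G u x y := by
    refine lt_of_le_of_ne (gromovProduct_nonneg hG) fun h0 => hxy ?_
    have : (G.dist x y : ℝ) = G.dist u x + G.dist u y := by
      rw [gromovProduct] at h0
      linarith
    exact_mod_cast this
  calc ℓ x * g x ^ 2 ≤ g x * g x * gromovProduct G u x x :=
        mul_sq_le_mul_gromovProduct (hℓ x hx)
    _ < g x * g x * gromovProduct G u x x + g x * g y * gromovProduct G u x y :=
        lt_add_of_pos_right _ (mul_pos (hg x hx y hy) hshared)
    _ ≤ ∑ z ∈ sideLeaves G u v, g x * g z * gromovProduct G u x z :=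
        add_le_sum (f := fun z => g x * g z * gromovProduct G u x z)
          (fun z hz => mul_nonneg (hg x hx z hz).le (gromovProduct_nonneg hG)) hx hy hne

lemma mul_dotProduct_self_eq (hG : G.IsTree) (huv : G.Adj u v) (hg : g ∈ leafCharges G) :
    μ * (g ⬝ᵥ g) =
      ∑ x ∈ sideLeaves G u v, (μ - ℓ x) * g x ^ 2 +
          ∑ y ∈ sideLeaves G v u, (μ - ℓ' y) * g y ^ 2 +
        (∑ x ∈ sideLeaves G u v, ℓ x * g x ^ 2 + ∑ y ∈ sideLeaves G v u, ℓ' y * g y ^ 2) := by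
  rw [dotProduct, sum_eq_sum_sideLeaves_add hG huv fun x hx => by rw [hg.1 x hx, mul_zero]]
  simp only [sub_mul, sum_sub_distrib, ← mul_sum, ← sq]
  ring

/-- `μ` solves the secular equation with arm lengths `ℓ` for the leaves on the `u`-side of the
edge `uv` and `ℓ'` for those on the `v`-side. -/
abbrev IsSecularRootAt (G : SimpleGraph V) (u v : V) (ℓ ℓ' : V → ℕ) (μ : ℝ) : Prop :=
  IsSecularRoot ((sideLeaves G u v).val.map ℓ) ((sideLeaves G v u).val.map ℓ') μ

lemma inv_le_steklovLambda₂_of_isSecularRootAt (hG : G.IsTree) (huv : G.Adj u v)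
    (hu : IsUnbranched G u v) (hv : IsUnbranched G v u)
    (hμ : IsSecularRootAt G u v (G.dist u) (G.dist v) μ) : μ⁻¹ ≤ steklovLambda₂ G := by
  have : Nontrivial V := ⟨u, v, huv.ne⟩
  refine inv_le_steklovLambda₂ hG fun g hg => ?_
  set s := ∑ x ∈ sideLeaves G u v, g x with hs
  have hsum : ∑ y ∈ sideLeaves G v u, g y = -s := by
    have := sum_eq_sum_sideLeaves_add hG huv hg.1
    rw [hg.2] at this
    exact eq_neg_of_add_eq_zero_right this.symm
  have hcauchyu := sum_sq_mul_inv_conductance_le (sideLeaves_nonempty hG huv) hμ.lt_of_mem g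
  have hcauchyv :=
    sum_sq_mul_inv_conductance_le (sideLeaves_nonempty hG huv.symm) hμ.symm.lt_of_mem g
  rw [hsum, neg_sq] at hcauchyv
  rw [mul_dotProduct_self_eq hG huv hg (ℓ := G.dist u) (ℓ' := G.dist v),
    flowEnergy_eq_sq_add_sideEnergy hG huv hg, sideEnergy_eq_of_isUnbranched hu,
    sideEnergy_eq_of_isUnbranched hv, add_assoc, ← hs]
  gcongr
  calc s ^ 2 = s ^ 2 * _ + s ^ 2 * _ := by rw [← mul_add, hμ.inv_add_inv, mul_one]
    _ ≤ _ := add_le_add hcauchyu hcauchyv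

/-- The leaf charge of the `λ₂`-eigenfunction of the double spider with arm lengths `ℓ` and `ℓ'`,
transplanted to the leaves on the two sides of the edge `uv`. -/
noncomputable def secularCharge (G : SimpleGraph V) (u v : V) (ℓ ℓ' : V → ℕ) (μ : ℝ) : V → ℝ :=
  armCharge (sideLeaves G u v) ℓ μ - armCharge (sideLeaves G v u) ℓ' μ

lemma neg_secularCharge : -secularCharge G u v ℓ ℓ' μ = secularCharge G v u ℓ' ℓ μ :=
  neg_sub _ _

lemma secularCharge_of_mem {x : V} (hx : x ∈ sideLeaves G u v) :
    secularCharge G u v ℓ ℓ' μ x = armCharge (sideLeaves G u v) ℓ μ x := by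
  rw [secularCharge, Pi.sub_apply,
    armCharge_of_notMem (Finset.disjoint_left.mp disjoint_sideLeaves hx), sub_zero]

lemma secularCharge_pos
    (hμ : IsSecularRootAt G u v ℓ ℓ' μ) {x : V} (hx : x ∈ sideLeaves G u v) :
    0 < secularCharge G u v ℓ ℓ' μ x := by
  rw [secularCharge_of_mem hx]
  exact armCharge_pos hμ.lt_of_mem hx

lemma secularCharge_mul_pos_left
    (hμ : IsSecularRootAt G u v ℓ ℓ' μ) :
    ∀ x ∈ sideLeaves G u v, ∀ y ∈ sideLeaves G u v,
      0 < secularCharge G u v ℓ ℓ' μ x * secularCharge G u v ℓ ℓ' μ y :=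
  fun _ hx _ hy => mul_pos (secularCharge_pos hμ hx) (secularCharge_pos hμ hy)

lemma secularCharge_mul_pos_right
    (hμ : IsSecularRootAt G u v ℓ ℓ' μ) :
    ∀ x ∈ sideLeaves G v u, ∀ y ∈ sideLeaves G v u,
      0 < secularCharge G u v ℓ ℓ' μ x * secularCharge G u v ℓ ℓ' μ y := by
  simpa [← neg_secularCharge (u := u)] using secularCharge_mul_pos_left hμ.symm

lemma sum_secularCharge (hG : G.IsTree) (huv : G.Adj u v)
    (hμ : IsSecularRootAt G u v ℓ ℓ' μ) :
    ∑ x ∈ sideLeaves G u v, secularCharge G u v ℓ ℓ' μ x = 1 :=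
  (sum_congr rfl fun _ hx => secularCharge_of_mem hx).trans
    (sum_armCharge (sideLeaves_nonempty hG huv) hμ.lt_of_mem)

lemma secularCharge_mem_leafCharges (hG : G.IsTree) (huv : G.Adj u v)
    (hμ : IsSecularRootAt G u v ℓ ℓ' μ) :
    secularCharge G u v ℓ ℓ' μ ∈ leafCharges G := by
  have hsupp : ∀ x, ¬ IsLeaf G x → secularCharge G u v ℓ ℓ' μ x = 0 := fun x hx => by
    simp [secularCharge, armCharge, mem_sideLeaves, hx]
  have hright := sum_secularCharge hG huv.symm hμ.symm
  simp only [← neg_secularCharge (u := u), Pi.neg_apply, sum_neg_distrib] at hright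
  refine ⟨hsupp, ?_⟩
  rw [sum_eq_sum_sideLeaves_add hG huv hsupp, sum_secularCharge hG huv hμ, ← hright]
  ring

lemma sum_mul_secularCharge_sq (hG : G.IsTree) (huv : G.Adj u v)
    (hμ : IsSecularRootAt G u v ℓ ℓ' μ) :
    ∑ x ∈ sideLeaves G u v, (μ - ℓ x) * secularCharge G u v ℓ ℓ' μ x ^ 2 =
      (conductance ((sideLeaves G u v).val.map ℓ) μ)⁻¹ := by
  rw [← sum_mul_armCharge_sq (sideLeaves_nonempty hG huv) hμ.lt_of_mem]
  exact sum_congr rfl fun x hx => by rw [secularCharge_of_mem hx]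

lemma mul_dotProduct_secularCharge (hG : G.IsTree) (huv : G.Adj u v)
    (hμ : IsSecularRootAt G u v ℓ ℓ' μ) :
    μ * (secularCharge G u v ℓ ℓ' μ ⬝ᵥ secularCharge G u v ℓ ℓ' μ) =
      1 + (∑ x ∈ sideLeaves G u v, ℓ x * secularCharge G u v ℓ ℓ' μ x ^ 2 +
        ∑ y ∈ sideLeaves G v u, ℓ' y * secularCharge G u v ℓ ℓ' μ y ^ 2) := by
  have hright := sum_mul_secularCharge_sq hG huv.symm hμ.symm
  simp only [← neg_secularCharge (u := u), Pi.neg_apply, neg_sq] at hright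
  rw [mul_dotProduct_self_eq hG huv (secularCharge_mem_leafCharges hG huv hμ),
    sum_mul_secularCharge_sq hG huv hμ, hright, hμ.inv_add_inv]

lemma flowEnergy_secularCharge (hG : G.IsTree) (huv : G.Adj u v)
    (hμ : IsSecularRootAt G u v ℓ ℓ' μ) :
    flowEnergy G (secularCharge G u v ℓ ℓ' μ) =
      1 + (sideEnergy G u v (secularCharge G u v ℓ ℓ' μ) +
        sideEnergy G v u (secularCharge G u v ℓ ℓ' μ)) := by
  rw [flowEnergy_eq_sq_add_sideEnergy hG huv (secularCharge_mem_leafCharges hG huv hμ),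
    sum_secularCharge hG huv hμ, one_pow, add_assoc]

lemma secularCharge_ne_zero (hG : G.IsTree) (huv : G.Adj u v)
    (hμ : IsSecularRootAt G u v ℓ ℓ' μ) :
    secularCharge G u v ℓ ℓ' μ ≠ 0 := by
  obtain ⟨x, hx⟩ := sideLeaves_nonempty hG huv
  exact fun h0 => (secularCharge_pos hμ hx).ne' (congrFun h0 x)

lemma steklovLambda₂_le_inv_of_isSecularRootAt (hG : G.IsTree) (huv : G.Adj u v)
    (hℓ : ∀ x ∈ sideLeaves G u v, ℓ x ≤ G.dist u x)
    (hℓ' : ∀ y ∈ sideLeaves G v u, ℓ' y ≤ G.dist v y)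
    (hμ : IsSecularRootAt G u v ℓ ℓ' μ) :
    steklovLambda₂ G ≤ μ⁻¹ := by
  refine steklovLambda₂_le_inv hG (secularCharge_mem_leafCharges hG huv hμ)
    (secularCharge_ne_zero hG huv hμ) (hμ.pos ?_) ?_
  · simpa using (sideLeaves_nonempty hG huv).ne_empty
  · rw [mul_dotProduct_secularCharge hG huv hμ, flowEnergy_secularCharge hG huv hμ]
    gcongr
    exacts [sum_mul_sq_le_sideEnergy hG.connected (secularCharge_mul_pos_left hμ) hℓ,
      sum_mul_sq_le_sideEnergy hG.connected (secularCharge_mul_pos_right hμ) hℓ']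

lemma steklovLambda₂_lt_inv_of_isSecularRootAt (hG : G.IsTree) (huv : G.Adj u v)
    (hℓ : ∀ x ∈ sideLeaves G u v, ℓ x ≤ G.dist u x)
    (hℓ' : ∀ y ∈ sideLeaves G v u, ℓ' y ≤ G.dist v y)
    (hμ : IsSecularRootAt G u v ℓ ℓ' μ)
    (hbr : ¬ IsUnbranched G u v) : steklovLambda₂ G < μ⁻¹ := by
  refine steklovLambda₂_lt_inv hG (secularCharge_mem_leafCharges hG huv hμ)
    (secularCharge_ne_zero hG huv hμ) (hμ.pos ?_) ?_
  · simpa using (sideLeaves_nonempty hG huv).ne_empty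
  · rw [mul_dotProduct_secularCharge hG huv hμ, flowEnergy_secularCharge hG huv hμ]
    gcongr ?_ + ?_
    exact add_lt_add_of_lt_of_le
      (sum_mul_sq_lt_sideEnergy hG.connected (secularCharge_mul_pos_left hμ) hℓ hbr)
      (sum_mul_sq_le_sideEnergy hG.connected (secularCharge_mul_pos_right hμ) hℓ')

end Comparison

section Iso

variable {V W : Type*} {G : SimpleGraph V} {H : SimpleGraph W}

lemma dist_map_le_of_hom (f : G →g H) (hG : G.Connected) (x y : V) :
    H.dist (f x) (f y) ≤ G.dist x y := by
  obtain ⟨p, hp⟩ := hG.exists_walk_length_eq_dist x y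
  rw [← hp, ← Walk.length_map f]
  exact dist_le _

lemma dist_map_eq_of_iso (e : G ≃g H) (hG : G.Connected) (x y : V) :
    H.dist (e x) (e y) = G.dist x y := by
  refine le_antisymm (dist_map_le_of_hom e.toHom hG x y) ?_
  simpa using dist_map_le_of_hom e.symm.toHom (e.connected_iff.mp hG) (e x) (e y)

lemma diam_eq_of_iso [Finite W] (e : G ≃g H) (hG : G.Connected) : G.diam = H.diam := by
  have : Finite V := .of_equiv W e.symm.toEquiv
  have hH := e.connected_iff.mp hG
  have := hG.nonempty
  have := hH.nonempty
  apply le_antisymm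
  · obtain ⟨x, y, hxy⟩ := G.exists_dist_eq_diam
    rw [← hxy, ← dist_map_eq_of_iso e hG]
    exact dist_le_diam_of_connected hH _ _
  · obtain ⟨x, y, hxy⟩ := H.exists_dist_eq_diam
    rw [← hxy, ← dist_map_eq_of_iso e.symm hH]
    exact dist_le_diam_of_connected hG _ _

lemma isLeaf_iff_of_iso (e : G ≃g H) (v : V) : IsLeaf H (e v) ↔ IsLeaf G v := by
  rw [IsLeaf, IsLeaf, e.bijective.existsUnique_iff]
  simp only [e.map_adj_iff]

lemma graphLaplacian_comp_iso [Fintype V] [Fintype W] (e : G ≃g H) (f : W → ℝ) (v : V) :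
    graphLaplacian G (f ∘ e) v = graphLaplacian H f (e v) :=
  sum_equiv e.toEquiv (by simp [← e.map_adj_iff (v := v)]) fun _ _ => rfl

lemma isSteklovEigenvalue_of_iso [Fintype V] [Fintype W] (e : G ≃g H) {μ : ℝ}
    (h : IsSteklovEigenvalue H μ) : IsSteklovEigenvalue G μ := by
  obtain ⟨hμ, f, hf, hint, hbd⟩ := h
  refine ⟨hμ, f ∘ e, fun h0 => hf (e.surjective.injective_comp_right h0), fun v hv => ?_,
    fun ω ω' hω hadj => ?_⟩
  · rw [graphLaplacian_comp_iso]
    exact hint _ ((isLeaf_iff_of_iso e v).not.mpr hv)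
  · exact hbd _ _ ((isLeaf_iff_of_iso e ω).mpr hω) (e.map_adj_iff.mpr hadj)

lemma steklovLambda₂_eq_of_iso [Fintype V] [Fintype W] (e : G ≃g H) :
    steklovLambda₂ G = steklovLambda₂ H := by
  unfold steklovLambda₂
  congr 1
  ext μ
  exact and_congr_right fun _ => ⟨isSteklovEigenvalue_of_iso e.symm, isSteklovEigenvalue_of_iso e⟩

lemma sideLeaves_eq_map_of_iso [Fintype V] [Fintype W] (e : G ≃g H) (hG : G.Connected) (u v : V) :
    sideLeaves H (e u) (e v) = (sideLeaves G u v).map e.toEquiv.toEmbedding := by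
  ext x
  obtain ⟨x, rfl⟩ := e.surjective x
  have : e x ∈ (sideLeaves G u v).map e.toEquiv.toEmbedding ↔ x ∈ sideLeaves G u v :=
    mem_map' e.toEquiv.toEmbedding
  simp only [this, mem_sideLeaves, mem_side, isLeaf_iff_of_iso, dist_map_eq_of_iso e hG]

lemma map_dist_sideLeaves_of_iso [Fintype V] [Fintype W] (e : G ≃g H) (hG : G.Connected)
    (u v : V) : (sideLeaves H (e u) (e v)).val.map (H.dist (e u)) =
      (sideLeaves G u v).val.map (G.dist u) := by
  rw [sideLeaves_eq_map_of_iso e hG, map_val, Multiset.map_map]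
  exact Multiset.map_congr rfl fun x _ => dist_map_eq_of_iso e hG u x

lemma isUnbranched_of_iso [Fintype V] [Fintype W] (e : G ≃g H) (hG : G.Connected) {u v : V}
    (h : IsUnbranched G u v) : IsUnbranched H (e u) (e v) := by
  rw [IsUnbranched, sideLeaves_eq_map_of_iso e hG, coe_map]
  refine (h.mono' fun x y hxy => ?_).image
  simpa [Function.onFun, dist_map_eq_of_iso e hG] using hxy

lemma nonempty_iso_of_bijective (hG : G.IsTree) (hH : H.Connected) (f : H →g G)
    (hf : Function.Bijective f) : Nonempty (G ≃g H) := by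
  let e : G.comap f ≃g G := Iso.comap (Equiv.ofBijective f hf) G
  have hmin := isTree_iff_minimal_connected.mp (e.isTree_iff.mpr hG)
  have hle : H ≤ G.comap f := fun _ _ hvw => f.map_adj hvw
  rw [le_antisymm hle (hmin.2 hH hle)]
  exact ⟨e.symm⟩

end Iso

namespace SpiderVertex

variable {n : ℕ} {ℓ : Fin n → ℕ}

/-- The distance of a vertex of a spider from the centre. -/
def height : SpiderVertex ℓ → ℕ
  | none => 0
  | some ⟨_, k⟩ => k + 1

/-- The neighbour of a vertex of a spider on the way to the centre, which is its own parent. -/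
def parent : SpiderVertex ℓ → SpiderVertex ℓ
  | none => none
  | some ⟨_, ⟨0, _⟩⟩ => none
  | some ⟨i, ⟨k + 1, h⟩⟩ => some ⟨i, ⟨k, Nat.lt_of_succ_lt h⟩⟩

/-- The height, counted negatively along the leg `i`. -/
def signedHeight (i : Fin n) : SpiderVertex ℓ → ℤ
  | none => 0
  | some ⟨j, k⟩ => if j = i then -(k + 1 : ℤ) else k + 1

/-- The end of the leg `i` of a spider. -/
def armEnd (hℓ : ∀ i, 1 ≤ ℓ i) (i : Fin n) : SpiderVertex ℓ :=
  some ⟨i, ⟨ℓ i - 1, Nat.sub_one_lt_of_lt (hℓ i)⟩⟩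

lemma height_parent {v : SpiderVertex ℓ} (hv : v ≠ none) : v.parent.height + 1 = v.height := by
  rcases v with _ | ⟨i, _ | k, hk⟩
  exacts [absurd rfl hv, rfl, rfl]

lemma abs_signedHeight_sub_parent_le (i : Fin n) (v : SpiderVertex ℓ) :
    |v.signedHeight i - v.parent.signedHeight i| ≤ 1 := by
  rcases v with _ | ⟨j, _ | k, hk⟩ <;> simp only [parent, signedHeight] <;> grind

lemma armEnd_injective (hℓ : ∀ i, 1 ≤ ℓ i) : Function.Injective (armEnd hℓ) := fun i j h => by
  simp only [armEnd, Option.some.injEq, Sigma.mk.injEq] at h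
  exact h.1

lemma height_armEnd (hℓ : ∀ i, 1 ≤ ℓ i) (i : Fin n) : (armEnd hℓ i).height = ℓ i :=
  Nat.sub_add_cancel (hℓ i)

lemma signedHeight_armEnd (hℓ : ∀ i, 1 ≤ ℓ i) (i j : Fin n) :
    (armEnd hℓ j).signedHeight i = if j = i then -(ℓ j : ℤ) else ℓ j := by
  simp only [armEnd, signedHeight, Nat.cast_sub (hℓ j), Nat.cast_one, sub_add_cancel]

lemma forall_parent_ne_iff (hℓ : ∀ i, 1 ≤ ℓ i) {v : SpiderVertex ℓ} (hv : v ≠ none) :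
    (∀ w : SpiderVertex ℓ, w.parent ≠ v) ↔ ∃ i, armEnd hℓ i = v := by
  constructor
  · rcases v with _ | ⟨i, k, hk⟩
    · exact absurd rfl hv
    · intro hchild
      obtain hk' | hk' := Nat.lt_or_eq_of_le (Nat.succ_le_of_lt hk)
      · exact absurd rfl (hchild (some ⟨i, ⟨k + 1, hk'⟩⟩))
      · exact ⟨i, by simp [armEnd, ← hk']⟩
  · rintro ⟨i, rfl⟩ (_ | ⟨j, _ | k, hk⟩) h
    · simp [parent, armEnd] at h
    · simp [parent, armEnd] at h
    · simp only [parent, armEnd, Option.some.injEq, Sigma.mk.injEq] at h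
      obtain ⟨rfl, h⟩ := h
      simp only [heq_eq_eq, Fin.mk.injEq] at h
      omega

lemma card_eq : Fintype.card (SpiderVertex ℓ) = 1 + ∑ i, ℓ i := by
  simp [Fintype.card_option, add_comm]

lemma isParentMap : IsParentMap (spider ℓ) none parent height where
  adj_iff := by
    rintro (_ | ⟨i, _ | k, hk⟩) (_ | ⟨j, _ | m, hm⟩) <;>
      simp [spider, spiderStep, parent] <;> grind
  height_root := rfl
  height_parent _ := height_parent

end SpiderVertex

section RootedSum

variable {V W : Type*} {G : SimpleGraph V} {H : SimpleGraph W} {u : V} {v : W}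

lemma isParentMap_sum_sup_edge [DecidableEq W] {π : V → V} {h : V → ℕ} {π' : W → W} {h' : W → ℕ}
    (hG : IsParentMap G u π h) (hH : IsParentMap H v π' h') :
    IsParentMap (SimpleGraph.sum G H ⊔ edge (.inl u) (.inr v)) (.inl u)
      (Sum.elim (fun x => .inl (π x)) (Function.update (fun y => .inr (π' y)) v (.inl u)))
      (Sum.elim h fun y => h' y + 1) where
  adj_iff := by
    rintro (x | x) (y | y) <;>
      simp [edge_adj, hG.adj_iff, hH.adj_iff, Function.update_apply] <;> grind
  height_root := hG.height_root
  height_parent := by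
    rintro (x | y) hne
    · exact hG.height_parent x (by simpa using hne)
    · by_cases hy : y = v
      · simp [hy, hG.height_root, hH.height_root]
      · simp [hy, hH.height_parent y hy]

end RootedSum

section DoubleSpider

open SpiderVertex

variable {p q : ℕ} {a : Fin p → ℕ} {b : Fin q → ℕ}

lemma isParentMap_doubleSpider : IsParentMap (doubleSpider a b) (.inl none)
    (Sum.elim (fun x => .inl x.parent)
      (Function.update (fun y => .inr y.parent) none (.inl none)))
    (Sum.elim height fun y => y.height + 1) :=
  isParentMap_sum_sup_edge isParentMap isParentMap

lemma doubleSpider_isTree : (doubleSpider a b).IsTree :=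
  isParentMap_doubleSpider.isTree

lemma doubleSpider_adj_centers : (doubleSpider a b).Adj (.inl none) (.inr none) := by
  simp [doubleSpider, edge_adj]

/-- The isomorphism exchanging the two sides of a double spider. -/
def doubleSpiderComm (a : Fin p → ℕ) (b : Fin q → ℕ) : doubleSpider a b ≃g doubleSpider b a where
  toEquiv := Equiv.sumComm _ _
  map_rel_iff' := by
    rintro (x | x) (y | y) <;> simp [doubleSpider, edge_adj]

lemma doubleSpider_dist_inl (z : SpiderVertex a ⊕ SpiderVertex b) :
    (doubleSpider a b).dist (.inl none) z = Sum.elim height (fun y => y.height + 1) z :=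
  isParentMap_doubleSpider.dist_root z

lemma doubleSpider_dist_inr (z : SpiderVertex a ⊕ SpiderVertex b) :
    (doubleSpider a b).dist (.inr none) z = Sum.elim (fun x => x.height + 1) height z := by
  have := dist_map_eq_of_iso (doubleSpiderComm b a) doubleSpider_isTree.connected (.inl none) z.swap
  rw [doubleSpider_dist_inl] at this
  rcases z with x | y <;> exact this

lemma isLeaf_doubleSpider_inl_iff [NeZero p] (ha : ∀ i, 1 ≤ a i) (x : SpiderVertex a) :
    IsLeaf (doubleSpider a b) (.inl x) ↔ ∃ i, armEnd ha i = x := by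
  rcases eq_or_ne x none with rfl | hx
  · refine iff_of_false ?_ (by simp [armEnd])
    refine not_isLeaf_of_adj_of_adj doubleSpider_adj_centers
      (isParentMap_doubleSpider.adj_parent (v := .inl (some ⟨0, ⟨0, ha 0⟩⟩)) (by simp)).symm
      (by simp)
  · rw [isParentMap_doubleSpider.isLeaf_iff (by simpa using hx), ← forall_parent_ne_iff ha hx]
    refine ⟨fun hchild w hw => ?_, fun hchild => ?_⟩
    · refine hchild (.inl w) ?_ (congrArg Sum.inl hw)
      rintro ⟨⟩
      exact hx hw.symm
    · rintro (w | w) -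
      · exact fun hw => hchild w (Sum.inl_injective hw)
      · by_cases hw : w = none <;> simp [hw, hx.symm]

lemma sideLeaves_doubleSpider_inl [NeZero p] (ha : ∀ i, 1 ≤ a i) :
    sideLeaves (doubleSpider a b) (.inl none) (.inr none) =
      univ.map ⟨fun i => .inl (armEnd ha i), Sum.inl_injective.comp (armEnd_injective ha)⟩ := by
  ext (x | y)
  · simp [mem_sideLeaves, mem_side, doubleSpider_dist_inl, doubleSpider_dist_inr,
      isLeaf_doubleSpider_inl_iff ha]
  · simp [mem_sideLeaves, mem_side, doubleSpider_dist_inl, doubleSpider_dist_inr]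
    omega

lemma map_dist_sideLeaves_doubleSpider_inl [NeZero p] (ha : ∀ i, 1 ≤ a i) :
    (sideLeaves (doubleSpider a b) (.inl none) (.inr none)).val.map
      ((doubleSpider a b).dist (.inl none)) = univ.val.map a := by
  rw [sideLeaves_doubleSpider_inl ha, map_val, Multiset.map_map]
  refine Multiset.map_congr rfl fun i _ => ?_
  simp [doubleSpider_dist_inl, height_armEnd]

lemma map_dist_sideLeaves_doubleSpider_inr [NeZero q] (hb : ∀ j, 1 ≤ b j) :
    (sideLeaves (doubleSpider a b) (.inr none) (.inl none)).val.map
      ((doubleSpider a b).dist (.inr none)) = univ.val.map b := by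
  rw [← map_dist_sideLeaves_doubleSpider_inl (b := a) hb]
  exact map_dist_sideLeaves_of_iso (doubleSpiderComm b a) doubleSpider_isTree.connected
    (.inl none) (.inr none)

lemma height_add_height_le_dist_armEnd (ha : ∀ i, 1 ≤ a i) {i j : Fin p} (hij : j ≠ i) :
    a i + a j ≤ (doubleSpider a b).dist (.inl (armEnd ha i)) (.inl (armEnd ha j)) := by
  have hdist := (isParentMap_doubleSpider (a := a) (b := b)).sub_le_dist
    (φ := Sum.elim (signedHeight i) fun y => y.height + 1) (fun v hv => ?_)
    (.inl (armEnd ha i)) (.inl (armEnd ha j))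
  · simp only [Sum.elim_inl, signedHeight_armEnd, hij, if_false, if_true] at hdist
    omega
  · rcases v with x | y
    · exact abs_signedHeight_sub_parent_le i x
    · rcases eq_or_ne y none with rfl | hy
      · simp [height, signedHeight]
      · simp [Function.update_of_ne hy, ← height_parent hy]

lemma isUnbranched_doubleSpider_inl [NeZero p] (ha : ∀ i, 1 ≤ a i) :
    IsUnbranched (doubleSpider a b) (.inl none) (.inr none) := by
  rw [IsUnbranched, sideLeaves_doubleSpider_inl ha, coe_map]
  rintro _ ⟨i, -, rfl⟩ _ ⟨j, -, rfl⟩ hne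
  have hij : j ≠ i := by
    rintro rfl
    exact hne rfl
  refine le_antisymm ?_ ?_
  · rw [(doubleSpider a b).dist_comm (u := .inl none)]
    exact doubleSpider_isTree.connected.dist_triangle
  · simpa [doubleSpider_dist_inl, height_armEnd] using height_add_height_le_dist_armEnd ha hij

lemma isUnbranched_doubleSpider_inr [NeZero q] (hb : ∀ j, 1 ≤ b j) :
    IsUnbranched (doubleSpider a b) (.inr none) (.inl none) :=
  isUnbranched_of_iso (doubleSpiderComm b a) doubleSpider_isTree.connected
    (u := .inl none) (v := .inr none) (isUnbranched_doubleSpider_inl hb)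

lemma isCentralEdge_doubleSpider [NeZero p] [NeZero q] (ha : ∀ i, 1 ≤ a i) (hb : ∀ j, 1 ≤ b j)
    {r : ℕ} (har : ∀ i, a i ≤ r) (hbr : ∀ j, b j ≤ r) (hra : ∃ i, a i = r) (hrb : ∃ j, b j = r) :
    IsCentralEdge (doubleSpider a b) r (.inl none) (.inr none) := by
  have hleft := map_dist_sideLeaves_doubleSpider_inl (b := b) ha
  have hright := map_dist_sideLeaves_doubleSpider_inr (a := a) hb
  refine ⟨doubleSpider_adj_centers, (Multiset.forall_mem_map_iff (p := (· ≤ r))).mp ?_,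
    (Multiset.forall_mem_map_iff (p := (· ≤ r))).mp ?_, Multiset.mem_map.mp ?_,
    Multiset.mem_map.mp ?_⟩
  · simpa [hleft] using har
  · simpa [hright] using hbr
  · simpa [hleft] using hra
  · simpa [hright] using hrb

lemma inv_le_steklovLambda₂_doubleSpider [NeZero p] [NeZero q] (ha : ∀ i, 1 ≤ a i)
    (hb : ∀ j, 1 ≤ b j) {μ : ℝ} (hμ : IsSecularRoot (univ.val.map a) (univ.val.map b) μ) :
    μ⁻¹ ≤ steklovLambda₂ (doubleSpider a b) := by
  refine inv_le_steklovLambda₂_of_isSecularRootAt doubleSpider_isTree doubleSpider_adj_centers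
    (isUnbranched_doubleSpider_inl ha) (isUnbranched_doubleSpider_inr hb) ?_
  rwa [IsSecularRootAt, map_dist_sideLeaves_doubleSpider_inl ha,
    map_dist_sideLeaves_doubleSpider_inr hb]

end DoubleSpider

lemma exists_isArmProfile {A : Multiset ℕ} {r : ℕ} (hr : r ∈ A) (hA : ∀ k ∈ A, 1 ≤ k ∧ k ≤ r) :
    ∃ (p : ℕ) (a : Fin (p + 1) → ℕ),
      IsArmProfile a ∧ a 0 = r ∧ (∀ i, a i ≤ r) ∧ univ.val.map a = A := by
  obtain ⟨n, a, ha, rfl⟩ : ∃ (n : ℕ) (a : Fin n → ℕ), Antitone a ∧ univ.val.map a = A :=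
    ⟨_, (A.sort (· ≥ ·)).get, (A.pairwise_sort (· ≥ ·)).sortedGE.antitone_get,
      by rw [Fin.univ_val_map, List.ofFn_get, Multiset.sort_eq]⟩
  have hbound : ∀ i, 1 ≤ a i ∧ a i ≤ r := fun i => hA _ (Multiset.mem_map_of_mem _ (mem_univ i))
  obtain ⟨i, -, rfl⟩ := Multiset.mem_map.mp hr
  obtain _ | p := n
  · exact i.elim0
  · exact ⟨p, a, ⟨ha, fun i => (hbound i).1⟩, (hbound 0).2.antisymm (ha (Fin.zero_le i)),
      fun i => (hbound i).2, rfl⟩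

lemma exists_doubleSpider {A B : Multiset ℕ} {r : ℕ} (hrA : r ∈ A) (hrB : r ∈ B)
    (hA : ∀ k ∈ A, 1 ≤ k ∧ k ≤ r) (hB : ∀ k ∈ B, 1 ≤ k ∧ k ≤ r) :
    ∃ (p q : ℕ) (a : Fin (p + 1) → ℕ) (b : Fin (q + 1) → ℕ),
      IsArmProfile a ∧ IsArmProfile b ∧ a 0 = r ∧ b 0 = r ∧ (∀ i, a i ≤ r) ∧ (∀ j, b j ≤ r) ∧
      Fintype.card (SpiderVertex a ⊕ SpiderVertex b) = (1 + A.sum) + (1 + B.sum) ∧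
      (doubleSpider a b).diam = 2 * r + 1 ∧
      ∀ μ : ℝ, IsSecularRoot A B μ → μ⁻¹ ≤ steklovLambda₂ (doubleSpider a b) := by
  obtain ⟨p, a, ha, ha0, har, rfl⟩ := exists_isArmProfile hrA hA
  obtain ⟨q, b, hb, hb0, hbr, rfl⟩ := exists_isArmProfile hrB hB
  refine ⟨p, q, a, b, ha, hb, ha0, hb0, har, hbr, ?_, ?_,
    fun μ => inv_le_steklovLambda₂_doubleSpider ha.2 hb.2⟩
  · rw [Fintype.card_sum, SpiderVertex.card_eq, SpiderVertex.card_eq]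
    rfl
  · exact (isCentralEdge_doubleSpider ha.2 hb.2 har hbr ⟨0, ha0⟩ ⟨0, hb0⟩).diam_eq
      doubleSpider_isTree

section Legs

variable {V : Type*} {G : SimpleGraph V} {u : V} {n : ℕ} {x : Fin n → V}

/-- The map from the spider whose legs have the lengths of the shortest walks from `u` to the
vertices `x i`, following these walks. -/
noncomputable def legMap (hG : G.Connected) (u : V) (x : Fin n → V) :
    SpiderVertex (fun i => G.dist u (x i)) → V
  | none => u
  | some ⟨_, k⟩ => (exists_isBetween_dist_eq hG (Nat.succ_le_of_lt k.isLt)).choose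

lemma isBetween_legMap_some (hG : G.Connected) (i : Fin n) (k : Fin (G.dist u (x i))) :
    IsBetween G u (legMap hG u x (some ⟨i, k⟩)) (x i) :=
  (exists_isBetween_dist_eq hG (Nat.succ_le_of_lt k.isLt)).choose_spec.1

lemma dist_legMap (hG : G.Connected) (v : SpiderVertex fun i => G.dist u (x i)) :
    G.dist u (legMap hG u x v) = v.height := by
  rcases v with _ | ⟨i, k⟩
  · exact G.dist_self
  · exact (exists_isBetween_dist_eq hG (Nat.succ_le_of_lt k.isLt)).choose_spec.2

lemma isBetween_legMap_parent (hG : G.Connected) (i : Fin n) (k : Fin (G.dist u (x i))) :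
    IsBetween G u (legMap hG u x (SpiderVertex.parent (some ⟨i, k⟩))) (x i) := by
  rcases k with ⟨_ | k, hk⟩
  · simp [IsBetween, SpiderVertex.parent, legMap]
  · exact isBetween_legMap_some hG i _

lemma adj_legMap_parent (hG : G.IsTree) {v : SpiderVertex fun i => G.dist u (x i)} (hv : v ≠ none) :
    G.Adj (legMap hG.connected u x v) (legMap hG.connected u x v.parent) := by
  obtain ⟨⟨i, k⟩, rfl⟩ := Option.ne_none_iff_exists'.mp hv
  have hw := isBetween_legMap_some hG.connected i k
  have hparent := isBetween_legMap_parent hG.connected i k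
  have hheight := SpiderVertex.height_parent hv
  simp only [← dist_legMap hG.connected] at hheight
  set w := legMap hG.connected u x (some ⟨i, k⟩)
  obtain ⟨z, hwz, hz⟩ := exists_adj_dist_add_one_eq hG.connected (u := u) (v := w) <| by
    rintro hwu
    rw [hwu, G.dist_self] at hheight
    omega
  have htri := hG.connected.dist_triangle (u := u) (v := z) (w := x i)
  have hstep := dist_le_dist_add_one_of_adj hG.connected (x i) hwz
  rw [G.dist_comm (v := z), G.dist_comm (v := w)] at hstep
  rwa [eq_of_isBetween_of_dist_eq hG hparent (w' := z) (by omega) (by omega)]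

lemma legMap_injective (hG : G.Connected)
    (hx : Pairwise fun i j => G.dist (x i) (x j) = G.dist u (x i) + G.dist u (x j)) :
    Function.Injective (legMap hG u x) := by
  intro v w hvw
  have hheight : v.height = w.height := by
    rw [← dist_legMap hG, ← dist_legMap hG, hvw]
  rcases v with _ | ⟨i, k⟩ <;> rcases w with _ | ⟨j, m⟩
  · rfl
  · cases hheight
  · cases hheight
  · have hij : i = j := by
      by_contra hij
      have hi := isBetween_legMap_some hG i k
      have hj := isBetween_legMap_some hG j m
      have hpos := dist_legMap hG (some ⟨i, k⟩)
      rw [hvw] at hi hpos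
      have htri := hG.dist_triangle (u := x i) (v := legMap hG u x (some ⟨j, m⟩)) (w := x j)
      rw [hx hij, G.dist_comm (u := x i)] at htri
      simp only [SpiderVertex.height] at hpos
      omega
    subst hij
    rw [Fin.ext (Nat.succ_injective hheight)]

lemma range_legMap (hG : G.IsTree) :
    Set.range (legMap hG.connected u x) = insert u {w | ∃ i, IsBetween G u w (x i)} := by
  ext w
  constructor
  · rintro ⟨_ | ⟨i, k⟩, rfl⟩
    exacts [.inl rfl, .inr ⟨i, isBetween_legMap_some hG.connected i k⟩]
  · rintro (rfl | ⟨i, hw⟩)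
    · exact ⟨none, rfl⟩
    · rcases eq_or_ne w u with rfl | hne
      · exact ⟨none, rfl⟩
      · have hpos := hG.connected.pos_dist_of_ne hne.symm
        have hk : G.dist u w - 1 < G.dist u (x i) := by omega
        refine ⟨some ⟨i, ⟨_, hk⟩⟩,
          eq_of_isBetween_of_dist_eq hG (isBetween_legMap_some hG.connected i ⟨_, hk⟩) hw ?_⟩
        rw [dist_legMap]
        exact Nat.sub_add_cancel hpos

lemma exists_antitone_enumeration {X : Finset V} (hX : X.Nonempty) (f : V → ℕ) :
    ∃ (p : ℕ) (x : Fin (p + 1) → V), Function.Injective x ∧ Set.range x = X ∧ Antitone (f ∘ x) := by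
  obtain ⟨p, hp⟩ := Nat.exists_eq_add_one_of_ne_zero hX.card_ne_zero
  let e : Fin (p + 1) ≃ X := (X.equivFinOfCardEq hp).symm
  let key := fun i => OrderDual.toDual (f (e i))
  refine ⟨p, fun i => e (Tuple.sort key i),
    Subtype.val_injective.comp (e.injective.comp (Tuple.sort key).injective), ?_,
    Tuple.monotone_sort key⟩
  ext v
  refine ⟨?_, fun hv => ⟨(Tuple.sort key).symm (e.symm ⟨v, hv⟩), by simp⟩⟩
  rintro ⟨i, rfl⟩
  exact (e _).2

lemma exists_spider_hom (hG : G.IsTree) {X : Finset V} (hX : X.Nonempty) (hu : u ∉ X)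
    (hdist : (X : Set V).Pairwise fun x y => G.dist x y = G.dist u x + G.dist u y) :
    ∃ (p : ℕ) (a : Fin (p + 1) → ℕ) (f : spider a →g G), IsArmProfile a ∧ f none = u ∧
      Function.Injective f ∧ Set.range f = insert u {w | ∃ x ∈ X, IsBetween G u w x} := by
  obtain ⟨p, x, hinj, hrange, hanti⟩ := exists_antitone_enumeration hX (G.dist u)
  have hmem : ∀ i, x i ∈ X := fun i => mem_coe.mp (hrange ▸ Set.mem_range_self i)
  have hadj : ∀ v w, (spider fun i => G.dist u (x i)).Adj v w →
      G.Adj (legMap hG.connected u x v) (legMap hG.connected u x w) := by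
    intro v w hvw
    rcases (SpiderVertex.isParentMap.adj_iff v w).mp hvw with ⟨hv, rfl⟩ | ⟨hw, rfl⟩
    exacts [adj_legMap_parent hG hv, (adj_legMap_parent hG hw).symm]
  refine ⟨p, fun i => G.dist u (x i), ⟨legMap hG.connected u x, hadj _ _⟩,
    ⟨hanti, fun i => hG.connected.pos_dist_of_ne (ne_of_mem_of_not_mem (hmem i) hu).symm⟩, rfl,
    legMap_injective hG.connected fun i j hij => hdist (hmem i) (hmem j) (hinj.ne hij), ?_⟩
  refine (range_legMap hG).trans ?_
  simp only [← mem_coe, ← hrange, Set.exists_range_iff]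

/-- The homomorphism from a double spider given by homomorphisms from its two spiders. -/
def doubleSpiderHom {p q : ℕ} {a : Fin p → ℕ} {b : Fin q → ℕ} (f : spider a →g G)
    (g : spider b →g G) (h : G.Adj (f none) (g none)) : doubleSpider a b →g G where
  toFun := Sum.elim f g
  map_rel' := by
    rintro (x | x) (y | y) hxy
    · exact f.map_adj (by simpa [doubleSpider, edge_adj] using hxy)
    · obtain ⟨rfl, rfl⟩ : x = none ∧ y = none := by simpa [doubleSpider, edge_adj] using hxy
      exact h
    · obtain ⟨rfl, rfl⟩ : x = none ∧ y = none := by simpa [doubleSpider, edge_adj] using hxy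
      exact h.symm
    · exact g.map_adj (by simpa [doubleSpider, edge_adj] using hxy)

end Legs

section Sides

variable {V : Type*} {G : SimpleGraph V} {u v w x : V}

lemma left_mem_side (huv : G.Adj u v) : u ∈ side G u v := by
  rw [mem_side, G.dist_self, dist_eq_one_iff_adj.mpr huv.symm]

lemma mem_side_of_isBetween (hG : G.Connected) (huv : G.Adj u v) (hx : x ∈ side G u v)
    (hw : IsBetween G u w x) : w ∈ side G u v := by
  have htri := hG.dist_triangle (u := v) (v := w) (w := x)
  have hstep := dist_le_dist_add_one_of_adj hG w huv
  rw [mem_side] at hx ⊢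
  rw [G.dist_comm (u := w), G.dist_comm (u := w)] at hstep
  omega

lemma mem_side_of_isBetween_of_ne (hG : G.IsTree) (huv : G.Adj u v) (hw : w ∈ side G u v)
    (hne : w ≠ u) (hx : IsBetween G u w x) : x ∈ side G u v := by
  have huv1 : G.dist v u = 1 := dist_eq_one_iff_adj.mpr huv.symm
  rw [mem_side, dist_eq_of_isBetween_of_isBetween hG hne.symm _ hx, huv1, add_comm]
  rw [IsBetween, huv1, add_comm]
  exact hw.symm

lemma not_isLeaf_of_mem_side (hG : G.Connected) (huv : G.Adj u v) (hx : x ∈ side G u v)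
    (hne : x ≠ u) : ¬ IsLeaf G u := by
  refine not_isLeaf_of_isBetween hG huv.ne hne.symm (u := v) ?_
  rw [IsBetween, dist_eq_one_iff_adj.mpr huv.symm, add_comm]
  exact hx.symm

lemma dist_add_one_add_dist_le_diam [Finite V] (hG : G.IsTree) (huv : G.Adj u v) {x y : V}
    (hx : x ∈ side G u v) (hy : y ∈ side G v u) : G.dist u x + 1 + G.dist v y ≤ G.diam :=
  dist_eq_of_mem_side_of_mem_side hG huv hx hy ▸ dist_le_diam_of_connected hG.connected x y

variable [Fintype V]

lemma side_eq_insert (hG : G.IsTree) (huv : G.Adj u v) :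
    side G u v = insert u {w | ∃ x ∈ sideLeaves G u v, IsBetween G u w x} := by
  ext w
  constructor
  · intro hw
    rcases eq_or_ne w u with rfl | hne
    · exact .inl rfl
    · obtain ⟨x, hleaf, hx⟩ := exists_isLeaf_isBetween hG hne
      exact .inr ⟨x, mem_sideLeaves.mpr
        ⟨hleaf, mem_side_of_isBetween_of_ne hG huv hw hne hx⟩, hx⟩
  · rintro (rfl | ⟨x, hx, hw⟩)
    · exact left_mem_side huv
    · exact mem_side_of_isBetween hG.connected huv (mem_sideLeaves.mp hx).2 hw

lemma isDoubleSpider_of_isUnbranched (hG : G.IsTree) (huv : G.Adj u v) (hu : ¬ IsLeaf G u)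
    (hv : ¬ IsLeaf G v) (hunb : IsUnbranched G u v) (hunb' : IsUnbranched G v u) :
    IsDoubleSpider G := by
  obtain ⟨p, a, f, ha, hf0, hf, hfr⟩ := exists_spider_hom hG (sideLeaves_nonempty hG huv)
    (fun h => hu (mem_sideLeaves.mp h).1) hunb
  obtain ⟨q, b, g, hb, hg0, hg, hgr⟩ := exists_spider_hom hG (sideLeaves_nonempty hG huv.symm)
    (fun h => hv (mem_sideLeaves.mp h).1) hunb'
  rw [← side_eq_insert hG huv] at hfr
  rw [← side_eq_insert hG huv.symm, ← compl_side hG huv] at hgr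
  have hadj : G.Adj (f none) (g none) := by rwa [hf0, hg0]
  refine ⟨p, q, a, b, ha, hb, nonempty_iso_of_bijective hG doubleSpider_isTree.connected
    (doubleSpiderHom f g hadj) ⟨hf.sumElim hg fun s t hst => ?_, fun w => ?_⟩⟩
  · have hs : f s ∈ side G u v := hfr ▸ Set.mem_range_self s
    have ht : g t ∈ (side G u v)ᶜ := hgr ▸ Set.mem_range_self t
    exact ht (hst ▸ hs)
  · change w ∈ Set.range (Sum.elim f g)
    rw [Set.Sum.elim_range, hfr, hgr, Set.union_compl_self]
    exact Set.mem_univ w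

lemma isSpider_of_sideLeaves_eq_singleton (hG : G.IsTree) (huv : G.Adj u v) (hu : ¬ IsLeaf G u)
    (hunb : IsUnbranched G u v) {y : V} (hy : sideLeaves G v u = {y}) : IsSpider G := by
  classical
  have hyv : y ∈ side G v u := (mem_sideLeaves.mp (hy ▸ mem_singleton_self y)).2
  have hcross : ∀ x ∈ sideLeaves G u v, G.dist x y = G.dist u x + G.dist u y := fun x hx => by
    rw [dist_eq_of_mem_side_of_mem_side hG huv (mem_sideLeaves.mp hx).2 hyv, mem_side.mp hyv]
    ring
  have hleaf : ∀ x, x ∈ insert y (sideLeaves G u v) ↔ IsLeaf G x := fun x => by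
    rw [mem_insert, ← mem_singleton, ← hy, mem_sideLeaves, mem_sideLeaves, ← compl_side hG huv,
      Set.mem_compl_iff]
    tauto
  have hpair : (↑(insert y (sideLeaves G u v)) : Set V).Pairwise fun x z =>
      G.dist x z = G.dist u x + G.dist u z := by
    rw [coe_insert]
    refine hunb.insert fun x hx _ => ⟨?_, hcross x hx⟩
    rw [dist_comm, hcross x hx, add_comm]
  obtain ⟨p, a, f, ha, -, hf, hfr⟩ := exists_spider_hom hG (insert_nonempty _ _)
    (fun h => hu ((hleaf u).mp h)) hpair
  refine ⟨p + 1, a, ha.2, nonempty_iso_of_bijective hG SpiderVertex.isParentMap.connected f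
    ⟨hf, fun w => ?_⟩⟩
  rw [← Set.mem_range, hfr]
  rcases eq_or_ne w u with rfl | hne
  · exact .inl rfl
  · obtain ⟨x, hx, hw⟩ := exists_isLeaf_isBetween hG hne
    exact .inr ⟨x, (hleaf x).mpr hx, hw⟩

lemma ncard_side_add_ncard_side (hG : G.IsTree) (huv : G.Adj u v) :
    (side G u v).ncard + (side G v u).ncard = Fintype.card V := by
  rw [← compl_side hG huv, Set.ncard_add_ncard_compl, Nat.card_eq_fintype_card]

lemma ncard_side_le (hG : G.IsTree) (huv : G.Adj u v) :
    (side G u v).ncard ≤ 1 + ∑ x ∈ sideLeaves G u v, G.dist u x := by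
  have hcard : ∀ x, ({w | IsBetween G u w x} \ {u}).ncard = G.dist u x := fun x => by
    rw [Set.ncard_sdiff_singleton_of_mem (by simp [IsBetween]), ncard_isBetween hG,
      Nat.add_sub_cancel]
  have hcover : side G u v = {u} ∪ ⋃ x ∈ sideLeaves G u v, {w | IsBetween G u w x} \ {u} := by
    ext w
    rw [side_eq_insert hG huv]
    simp only [Set.mem_insert_iff, Set.mem_ofPred_eq, Set.mem_union, Set.mem_singleton_iff,
      Set.mem_iUnion, Set.mem_sdiff, exists_prop]
    tauto
  calc (side G u v).ncard
      ≤ 1 + (⋃ x ∈ sideLeaves G u v, {w | IsBetween G u w x} \ {u}).ncard := by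
        rw [hcover, ← Set.ncard_singleton u]
        exact Set.ncard_union_le _ _
    _ ≤ 1 + ∑ x ∈ sideLeaves G u v, ({w | IsBetween G u w x} \ {u}).ncard :=
        Nat.add_le_add_left (set_ncard_biUnion_le _ _) 1
    _ = _ := by simp only [hcard]

lemma dist_add_card_sideLeaves_le_ncard_side (hG : G.IsTree) (huv : G.Adj u v)
    (hx : x ∈ sideLeaves G u v) (hu : ¬ IsLeaf G u) :
    G.dist u x + (sideLeaves G u v).card ≤ (side G u v).ncard := by
  classical
  have hxside := (mem_sideLeaves.mp hx).2
  have hdisj : Disjoint {w | IsBetween G u w x} ((sideLeaves G u v).erase x : Set V) := by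
    rw [Set.disjoint_left]
    intro w hw hmem
    obtain ⟨hwx, hw'⟩ := mem_erase.mp (mem_coe.mp hmem)
    have hleaf := (mem_sideLeaves.mp hw').1
    exact not_isLeaf_of_isBetween hG.connected (by rintro rfl; exact hu hleaf) hwx hw hleaf
  have hsub : {w | IsBetween G u w x} ∪ ((sideLeaves G u v).erase x : Set V) ⊆ side G u v := by
    rintro w (hw | hw)
    · exact mem_side_of_isBetween hG.connected huv hxside hw
    · exact (mem_sideLeaves.mp (mem_of_mem_erase (mem_coe.mp hw))).2
  have hcard := Set.ncard_le_ncard hsub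
  rw [Set.ncard_union_eq hdisj, ncard_isBetween hG, Set.ncard_coe_finset] at hcard
  have := card_erase_add_one hx
  omega

end Sides

lemma exists_sum_eq_of_le_of_le {ι : Type*} {S : Finset ι} {m k : ι → ℕ} (hmk : ∀ i ∈ S, m i ≤ k i)
    {N : ℕ} (hm : ∑ i ∈ S, m i ≤ N) (hk : N ≤ ∑ i ∈ S, k i) :
    ∃ ℓ : ι → ℕ, (∀ i ∈ S, m i ≤ ℓ i ∧ ℓ i ≤ k i) ∧ ∑ i ∈ S, ℓ i = N := by
  classical
  induction N, hm using Nat.le_induction with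
  | base => exact ⟨m, fun i hi => ⟨le_rfl, hmk i hi⟩, rfl⟩
  | succ N _ ih =>
    obtain ⟨ℓ, hℓ, hsum⟩ := ih (by omega)
    obtain ⟨i, hi, hlt⟩ := exists_lt_of_sum_lt (hsum.trans_lt hk)
    refine ⟨ℓ + Pi.single i 1, fun j hj => ?_, ?_⟩
    · have := hℓ j hj
      rcases eq_or_ne j i with rfl | hji
      · simp; omega
      · simpa [hji] using this
    · simp [sum_add_distrib, hsum, hi]

section CentralEdge

variable {V : Type*} [Fintype V] {G : SimpleGraph V} {u v : V} {r : ℕ}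

lemma exists_isCentralEdge (hG : G.IsTree) (hd : G.diam = 2 * r + 1) :
    ∃ u v, IsCentralEdge G r u v := by
  have := hG.connected.nonempty
  obtain ⟨x, y, hxy⟩ := G.exists_dist_eq_diam
  have hne : x ≠ y := by
    rintro rfl
    rw [G.dist_self] at hxy
    omega
  have hleafx := isLeaf_of_dist_eq_diam hG hne hxy
  have hleafy := isLeaf_of_dist_eq_diam hG hne.symm (by rw [dist_comm, hxy])
  obtain ⟨u, hu, hux⟩ := exists_isBetween_dist_eq hG.connected (u := x) (x := y) (k := r) (by omega)
  obtain ⟨v, huv, hv⟩ := exists_adj_dist_add_one_eq hG.connected (u := y) (v := u) <| by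
    rintro rfl
    rw [IsBetween, G.dist_self] at hu
    omega
  have htri := hG.connected.dist_triangle (u := x) (v := v) (w := y)
  have hstep := dist_le_dist_add_one_of_adj hG.connected x huv
  rw [IsBetween] at hu
  rw [G.dist_comm (u := y), G.dist_comm (u := y)] at hv
  have hxu : G.dist u x = r := by rw [G.dist_comm, hux]
  have hx : x ∈ side G u v := by
    rw [mem_side, G.dist_comm (u := v), hxu]
    omega
  have hy : y ∈ side G v u := by
    rw [mem_side]
    omega
  refine ⟨u, v, huv, fun w hw => ?_, fun w hw => ?_,
    ⟨x, mem_sideLeaves.mpr ⟨hleafx, hx⟩, hxu⟩,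
    ⟨y, mem_sideLeaves.mpr ⟨hleafy, hy⟩, by omega⟩⟩
  · have := dist_add_one_add_dist_le_diam hG huv (mem_sideLeaves.mp hw).2 hy
    omega
  · have := dist_add_one_add_dist_le_diam hG huv hx (mem_sideLeaves.mp hw).2
    omega

namespace IsCentralEdge

lemma not_isLeaf_left (hG : G.Connected) (hr : 1 ≤ r) (h : IsCentralEdge G r u v) :
    ¬ IsLeaf G u := by
  obtain ⟨x, hx, hxr⟩ := h.exists_left
  refine not_isLeaf_of_mem_side hG h.adj (mem_sideLeaves.mp hx).2 ?_
  rintro rfl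
  rw [G.dist_self] at hxr
  omega

lemma isDoubleSpider (hG : G.IsTree) (hr : 1 ≤ r) (h : IsCentralEdge G r u v)
    (hu : IsUnbranched G u v) (hv : IsUnbranched G v u) : IsDoubleSpider G :=
  isDoubleSpider_of_isUnbranched hG h.adj (h.not_isLeaf_left hG.connected hr)
    (h.symm.not_isLeaf_left hG.connected hr) hu hv

lemma isSpider (hG : G.IsTree) (hr : 1 ≤ r) (h : IsCentralEdge G r u v)
    (hu : IsUnbranched G u v) (hv : (sideLeaves G v u).card = 1) : IsSpider G := by
  obtain ⟨y, hy⟩ := card_eq_one.mp hv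
  exact isSpider_of_sideLeaves_eq_singleton hG h.adj (h.not_isLeaf_left hG.connected hr) hu hy

/-- Shortening the depths of the leaves other than a deepest one makes up for the vertices shared
by several legs. -/
lemma exists_armLengths (hG : G.IsTree) (hr : 1 ≤ r) (h : IsCentralEdge G r u v) :
    ∃ ℓ : V → ℕ, (∀ x ∈ sideLeaves G u v, ℓ x ≤ G.dist u x) ∧
      (∀ k ∈ (sideLeaves G u v).val.map ℓ, 1 ≤ k ∧ k ≤ r) ∧ r ∈ (sideLeaves G u v).val.map ℓ ∧
      1 + ((sideLeaves G u v).val.map ℓ).sum = (side G u v).ncard := by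
  classical
  obtain ⟨x, hx, hxr⟩ := h.exists_left
  have hu := h.not_isLeaf_left hG.connected hr
  have hpos : ∀ w ∈ sideLeaves G u v, 1 ≤ G.dist u w := fun w hw =>
    hG.connected.pos_dist_of_ne (by rintro rfl; exact hu (mem_sideLeaves.mp hw).1)
  have hlower := dist_add_card_sideLeaves_le_ncard_side hG h.adj hx hu
  have hupper := ncard_side_le hG h.adj
  let m : V → ℕ := Function.update 1 x r
  have hm : ∀ w ∈ sideLeaves G u v, m w ≤ G.dist u w := fun w hw => by
    rcases eq_or_ne w x with rfl | hwx
    · simp [m, hxr]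
    · simpa [m, hwx] using hpos w hw
  have hsum_m : ∑ w ∈ sideLeaves G u v, m w ≤ (side G u v).ncard - 1 := by
    have := card_erase_add_one hx
    rw [sum_update_of_mem hx, sdiff_singleton_eq_erase]
    simp only [Pi.one_apply, sum_const, smul_eq_mul, mul_one]
    omega
  obtain ⟨ℓ, hℓ, hsum⟩ := exists_sum_eq_of_le_of_le hm hsum_m (by omega)
  have hℓ_pos : ∀ w ∈ sideLeaves G u v, 1 ≤ ℓ w := fun w hw => by
    refine le_trans ?_ (hℓ w hw).1
    rcases eq_or_ne w x with rfl | hwx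
    · simpa [m] using hr
    · simp [m, hwx]
  have hℓx : ℓ x = r := by
    simpa [m, hxr, le_antisymm_iff, and_comm] using hℓ x hx
  refine ⟨ℓ, fun w hw => (hℓ w hw).2, ?_, Multiset.mem_map.mpr ⟨x, hx, hℓx⟩, ?_⟩
  · exact Multiset.forall_mem_map_iff.mpr fun w hw =>
      ⟨hℓ_pos w hw, (hℓ w hw).2.trans (h.dist_le_left w hw)⟩
  · change 1 + ∑ w ∈ sideLeaves G u v, ℓ w = _
    omega

end IsCentralEdge

end CentralEdge

lemma IsDoubleSpider.isTree {V : Type*} {G : SimpleGraph V} (h : IsDoubleSpider G) :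
    G.IsTree := by
  obtain ⟨p, q, a, b, -, -, ⟨e⟩⟩ := h
  exact e.isTree_iff.mpr doubleSpider_isTree

section Maximizers

variable {V : Type*} [Fintype V] {G : SimpleGraph V} {u v : V} {r : ℕ}

lemma exists_isDoubleSpider_of_card_eq {p q : ℕ} {a : Fin (p + 1) → ℕ} {b : Fin (q + 1) → ℕ}
    (ha : IsArmProfile a) (hb : IsArmProfile b)
    (hcard : Fintype.card (SpiderVertex a ⊕ SpiderVertex b) = Fintype.card V) :
    ∃ G : SimpleGraph V, IsDoubleSpider G ∧ G.diam = (doubleSpider a b).diam ∧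
      steklovLambda₂ G = steklovLambda₂ (doubleSpider a b) := by
  let equiv : V ≃ SpiderVertex a ⊕ SpiderVertex b := Fintype.equivOfCardEq hcard.symm
  let e : (doubleSpider a b).comap equiv ≃g doubleSpider a b := Iso.comap equiv _
  have hG : IsDoubleSpider ((doubleSpider a b).comap equiv) := ⟨p, q, a, b, ha, hb, ⟨e⟩⟩
  exact ⟨_, hG, diam_eq_of_iso e hG.isTree.connected, steklovLambda₂_eq_of_iso e⟩

lemma IsCentralEdge.exists_doubleSpider_ge (hG : G.IsTree) (hr : 1 ≤ r)
    (h : IsCentralEdge G r u v) :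
    ∃ (p q : ℕ) (a : Fin (p + 1) → ℕ) (b : Fin (q + 1) → ℕ),
      IsArmProfile a ∧ IsArmProfile b ∧
      a 0 = r ∧ b 0 = r ∧ (∀ i, a i ≤ r) ∧ (∀ j, b j ≤ r) ∧
      Fintype.card (SpiderVertex a ⊕ SpiderVertex b) = Fintype.card V ∧
      (doubleSpider a b).diam = 2 * r + 1 ∧
      steklovLambda₂ G ≤ steklovLambda₂ (doubleSpider a b) ∧
      (steklovLambda₂ G = steklovLambda₂ (doubleSpider a b) →
        IsUnbranched G u v ∧ IsUnbranched G v u) := by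
  obtain ⟨ℓ, hℓ, hA, hrA, hcardA⟩ := h.exists_armLengths hG hr
  obtain ⟨ℓ', hℓ', hB, hrB, hcardB⟩ := h.symm.exists_armLengths hG hr
  obtain ⟨μ, hμ⟩ := exists_isSecularRoot (fun k hk => (hA k hk).2) (fun k hk => (hB k hk).2) hrA hrB
  obtain ⟨p, q, a, b, ha, hb, ha0, hb0, har, hbr, hcard, hdiam, hle⟩ :=
    exists_doubleSpider hrA hrB hA hB
  refine ⟨p, q, a, b, ha, hb, ha0, hb0, har, hbr, ?_, hdiam,
    (steklovLambda₂_le_inv_of_isSecularRootAt hG h.adj hℓ hℓ' hμ).trans (hle μ hμ),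
    fun heq => ⟨?_, ?_⟩⟩
  · rw [hcard, hcardA, hcardB, ncard_side_add_ncard_side hG h.adj]
  · by_contra hbranched
    exact ((steklovLambda₂_lt_inv_of_isSecularRootAt hG h.adj hℓ hℓ' hμ hbranched).trans_le
      (hle μ hμ)).ne heq
  · by_contra hbranched
    exact ((steklovLambda₂_lt_inv_of_isSecularRootAt hG h.adj.symm hℓ' hℓ hμ.symm
      hbranched).trans_le (hle μ hμ)).ne heq

lemma IsCentralEdge.exists_armLengths_cons (hG : G.IsTree) (hr : 1 ≤ r)
    (h : IsCentralEdge G r u v) (hone : (sideLeaves G u v).card ≠ 1) :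
    ∃ (ℓ : V → ℕ) (A : Multiset ℕ), (∀ x ∈ sideLeaves G u v, ℓ x ≤ G.dist u x) ∧
      (sideLeaves G u v).val.map ℓ = r ::ₘ A ∧ A ≠ 0 ∧ (∀ k ∈ A, 1 ≤ k ∧ k ≤ r) ∧
      1 + (r + A.sum) = (side G u v).ncard := by
  obtain ⟨ℓ, hℓ, hbound, hmem, hcard⟩ := h.exists_armLengths hG hr
  obtain ⟨A, hA⟩ := Multiset.exists_cons_of_mem hmem
  rw [hA] at hbound hcard
  refine ⟨ℓ, A, hℓ, hA, ?_, fun k hk => hbound k (Multiset.mem_cons_of_mem hk),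
    by rwa [Multiset.sum_cons] at hcard⟩
  rintro rfl
  exact hone (by simpa using congrArg Multiset.card hA)

-- All arms at `v` but a longest one are moved to `u`.
lemma IsCentralEdge.exists_isDoubleSpider_lt (hG : G.IsTree) (hr : 1 ≤ r)
    (h : IsCentralEdge G r u v) (hu : IsUnbranched G u v) (hv : IsUnbranched G v u)
    (hs : ¬ IsSpider G) :
    ∃ G' : SimpleGraph V, IsDoubleSpider G' ∧ G'.diam = 2 * r + 1 ∧
      steklovLambda₂ G < steklovLambda₂ G' := by
  obtain ⟨ℓ, A, hℓ, hmapA, hA0, hA, hcardA⟩ :=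
    h.exists_armLengths_cons hG hr fun hone => hs (h.symm.isSpider hG hr hv hone)
  obtain ⟨ℓ', B, hℓ', hmapB, hB0, hB, hcardB⟩ :=
    h.symm.exists_armLengths_cons hG hr fun hone => hs (h.isSpider hG hr hu hone)
  have hrA : ∀ k ∈ r ::ₘ A, 1 ≤ k ∧ k ≤ r := Multiset.forall_mem_cons.mpr ⟨⟨hr, le_rfl⟩, hA⟩
  have hrB : ∀ k ∈ r ::ₘ B, 1 ≤ k ∧ k ≤ r := Multiset.forall_mem_cons.mpr ⟨⟨hr, le_rfl⟩, hB⟩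
  have hrAB : ∀ k ∈ r ::ₘ A + B, 1 ≤ k ∧ k ≤ r := fun k hk =>
    (Multiset.mem_add.mp hk).elim (hrA k) (hB k)
  have hr' : ∀ k ∈ ({r} : Multiset ℕ), 1 ≤ k ∧ k ≤ r := by simpa using hr
  have hmem : r ∈ r ::ₘ A + B := Multiset.mem_add.mpr (.inl (Multiset.mem_cons_self r A))
  obtain ⟨μ, hμ⟩ := exists_isSecularRoot (fun k hk => (hrA k hk).2) (fun k hk => (hrB k hk).2)
    (Multiset.mem_cons_self r A) (Multiset.mem_cons_self r B)
  obtain ⟨μ', hμ'⟩ := exists_isSecularRoot (fun k hk => (hrAB k hk).2) (fun k hk => (hr' k hk).2)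
    hmem (Multiset.mem_singleton_self r)
  obtain ⟨p, q, a, b, ha, hb, -, -, -, -, hcard, hdiam, hle⟩ :=
    exists_doubleSpider hmem (Multiset.mem_singleton_self r) hrAB hr'
  have hcardV : Fintype.card (SpiderVertex a ⊕ SpiderVertex b) = Fintype.card V := by
    rw [hcard, ← ncard_side_add_ncard_side hG h.adj, ← hcardA, ← hcardB]
    simp only [Multiset.sum_add, Multiset.sum_cons, Multiset.sum_singleton]
    ring
  obtain ⟨G', hG', hdiam', hlambda⟩ := exists_isDoubleSpider_of_card_eq ha hb hcardV
  refine ⟨G', hG', hdiam'.trans hdiam, ?_⟩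
  have hpos : 0 < μ' := hμ'.pos fun h0 => Multiset.notMem_zero r (h0 ▸ hmem)
  calc steklovLambda₂ G
      ≤ μ⁻¹ := steklovLambda₂_le_inv_of_isSecularRootAt hG h.adj hℓ hℓ'
        (by rwa [IsSecularRootAt, hmapA, hmapB])
    _ < μ'⁻¹ := inv_strictAnti₀ hpos (hμ.lt_of_transfer hA0 hB0 hμ')
    _ ≤ steklovLambda₂ G' := hlambda ▸ hle μ' hμ'

lemma exists_isDoubleSpider_lt (hG : G.IsTree) (hr : 1 ≤ r) (hd : G.diam = 2 * r + 1)
    (hs : ¬ IsSpider G) :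
    ∃ G' : SimpleGraph V, IsDoubleSpider G' ∧ G'.diam = 2 * r + 1 ∧
      steklovLambda₂ G < steklovLambda₂ G' := by
  obtain ⟨u, v, h⟩ := exists_isCentralEdge hG hd
  obtain ⟨p, q, a, b, ha, hb, -, -, -, -, hcard, hdiam, hle, hunbranched⟩ :=
    h.exists_doubleSpider_ge hG hr
  rcases hle.lt_or_eq with hlt | heq
  · obtain ⟨G', hG', hdiam', hlambda⟩ := exists_isDoubleSpider_of_card_eq ha hb hcard
    exact ⟨G', hG', hdiam'.trans hdiam, hlambda ▸ hlt⟩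
  · exact h.exists_isDoubleSpider_lt hG hr (hunbranched heq).1 (hunbranched heq).2 hs

end Maximizers

/-- `V` is a vertex set of order `n`, so that the graphs on `V` are, up to isomorphism, all graphs
of order `n`; the diameter is `2 * r + 1`. -/
theorem theorem1p3 {V : Type*} [Fintype V] (r n : ℕ) (hr : 1 ≤ r) (hn : 2 * r + 2 ≤ n)
    (hV : Fintype.card V = n) :
    -- every tree is dominated by a double spider of the same order and diameter, with rigidity
    (∀ T : SimpleGraph V, T.IsTree → T.diam = 2 * r + 1 →
      ∃ (p q : ℕ) (a : Fin (p + 1) → ℕ) (b : Fin (q + 1) → ℕ),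
        IsArmProfile a ∧ IsArmProfile b ∧
        a 0 = r ∧ b 0 = r ∧ (∀ i, a i ≤ r) ∧ (∀ j, b j ≤ r) ∧
        Fintype.card (SpiderVertex a ⊕ SpiderVertex b) = n ∧
        (doubleSpider a b).diam = 2 * r + 1 ∧
        steklovLambda₂ T ≤ steklovLambda₂ (doubleSpider a b) ∧
        (steklovLambda₂ T = steklovLambda₂ (doubleSpider a b) → IsDoubleSpider T)) ∧
    -- every extremal double spider is a spider
    (∀ T : SimpleGraph V, IsDoubleSpider T → T.diam = 2 * r + 1 →
      (∀ T' : SimpleGraph V, IsDoubleSpider T' → T'.diam = 2 * r + 1 →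
        steklovLambda₂ T' ≤ steklovLambda₂ T) →
      IsSpider T) ∧
    -- every extremizer among all trees is a spider
    (∀ T : SimpleGraph V, T.IsTree → T.diam = 2 * r + 1 →
      (∀ T' : SimpleGraph V, T'.IsTree → T'.diam = 2 * r + 1 →
        steklovLambda₂ T' ≤ steklovLambda₂ T) →
      IsSpider T) := by
  subst hV
  refine ⟨fun T hT hd => ?_, fun T hT hd hmax => ?_, fun T hT hd hmax => ?_⟩
  · obtain ⟨u, v, h⟩ := exists_isCentralEdge hT hd
    obtain ⟨p, q, a, b, ha, hb, ha0, hb0, har, hbr, hcard, hdiam, hle, hunbranched⟩ :=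
      h.exists_doubleSpider_ge hT hr
    exact ⟨p, q, a, b, ha, hb, ha0, hb0, har, hbr, hcard, hdiam, hle,
      fun heq => h.isDoubleSpider hT hr (hunbranched heq).1 (hunbranched heq).2⟩
  · by_contra hs
    obtain ⟨T', hT', hd', hlt⟩ := exists_isDoubleSpider_lt hT.isTree hr hd hs
    exact hlt.not_ge (hmax T' hT' hd')
  · by_contra hs
    obtain ⟨T', hT', hd', hlt⟩ := exists_isDoubleSpider_lt hT hr hd hs
    exact hlt.not_ge (hmax T' hT'.isTree hd')
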